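/- **Setting.** A non-interactive local protocol for $n$ users over the data universe $[d]$ consists of randomizers $R_1,\dots,R_n$, an aggregator $A$ and a distribution $\mathbf S$ of a public random string $S$: user $i$ holding $x_i\in[d]$ sends $y_i\sim R_i(x_i,S)$ (independently across users given $S$), and the output is $z\sim A(y_1,\dots,y_n,S)\in\mathbb R^d$. Message space and public-string space are measurable spaces such that the public-string space is countable or the $\sigma$-algebra of the message space is countably generated. The protocol is $\varepsilon$-LDP if $\Pr[R_i(x,s)\in E]\le e^{\varepsilon}\Pr[R_i(x',s)\in E]$ for all $i,x,x',s$ and all measurable $E$. An attacker $M$ corrupting $m$ users sees $S$ and chooses, possibly at random, a set $C$ of at most $m$ users and arbitrary messages for them; the users outside $C$ behave honestly. Write $\mathrm{Manip}(\Pi,\vec x,M)$ for the output on data $\vec x\in[d]^n$, and $\mathrm{Manip}(\Pi,\mathbf P,M)$ for the output when $\vec x$ consists of $n$ independent samples from $\mathbf P$ (the attacker does not see them). Let $\mathrm{freq}(\vec x)\in\mathbb R^d$ be the vector with entries $\frac1n|\{i:x_i=j\}|$. Say that $\Pi$ *can be manipulated by $m$ users into error $\alpha$* if both of the following hold: 1.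 there are a dataset $\vec x\in[d]^n$ and an attacker $M$ corrupting $m$ users with $\Pr\big[\|\mathrm{Manip}(\Pi,\vec x,M)-\mathrm{freq}(\vec x)\|_1\ge\alpha\big]\ge\frac13$; 2. there are a distribution $\mathbf P$ on $[d]$ and an attacker $M$ corrupting $m$ users with $\Pr\big[\|\mathrm{Manip}(\Pi,\mathbf P,M)-\mathbf P\|_1\ge\alpha\big]\ge\frac13$. The breakdown point of $\Pi$ at accuracy $\alpha$, for estimation of the dataset frequencies (respectively, of the distribution), is the supremum of $m/n$ over all $m\le n$ for which item 1 (respectively, item 2) fails; it is $0$ if there is no such $m$. **Theorem.** For every $\varepsilon_0>0$ there are constants $c,C>0$ such that for all $n,d\ge2$, all $0<\varepsilon\le\varepsilon_0$ and every $\varepsilon$-LDP non-interactive protocol $\Pi$ as above: (a) for every $0\le m\le n$, $\Pi$ can be manipulated by $m$ users into error $$c\cdot\min\Big\{1,\ \frac mn\cdot\frac{\sqrt d}{\varepsilon\sqrt{\log n}}\Big\};$$ consequently both breakdown points of $\Pi$ at accuracy $c$ are at most $C\,\varepsilon\sqrt{\log n/d}$. (b) If the message space $\mathcal Y$ is finite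 and $r$ is the number of distinct randomizers among $R_1,\dots,R_n$, then (a) also holds with $\log n$ replaced by $\log(12\,|\mathcal Y|\,r)$, both in the error and in the bound on the breakdown points. (Thus the factor $\sqrt{\log n}$ can be dropped for protocols for which $|\mathcal Y|\cdot r$ is bounded.) -/

import Mathlib

open MeasureTheory ProbabilityTheory

noncomputable section

/-- A non-interactive local protocol for `n` users with data universe `X`, public random strings
in `S`, messages in `Y` and outputs in `Z`. User `i` applies the (randomized) local randomizer
`randomizer i` to its datum and the public string; the (possibly randomized) aggregator is applied
to the vector of messages and the public string. -/
structure LocalProtocol (n : ℕ) (X S Y Z : Type*) [MeasurableSpace X] [MeasurableSpace S]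
    [MeasurableSpace Y] [MeasurableSpace Z] where
  randomizer : Fin n → Kernel (X × S) Y
  aggregator : Kernel ((Fin n → Y) × S) Z
  publicLaw : Measure S
  randomizer_markov : ∀ i, IsMarkovKernel (randomizer i)
  aggregator_markov : IsMarkovKernel aggregator
  publicLaw_prob : IsProbabilityMeasure publicLaw

attribute [instance] LocalProtocol.randomizer_markov LocalProtocol.aggregator_markov
  LocalProtocol.publicLaw_prob

/-- An attacker corrupting at most `m` of the `n` users. Having seen the public string `s`, it
chooses, possibly at random and in a coordinated way, a set of corrupted users and messages for
them: `strategy s` is the joint law of the corrupted set and of a message vector, of which only the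
entries of corrupted users are used. The attacker sees neither the data nor the honest messages. -/
structure Attacker (n m : ℕ) (S Y : Type*) [MeasurableSpace S] [MeasurableSpace Y] where
  strategy : Kernel S (Set (Fin n) × (Fin n → Y))
  strategy_markov : IsMarkovKernel strategy
  card_le : ∀ s, ∀ᵐ p ∂(strategy s), p.1.ncard ≤ m

attribute [instance] Attacker.strategy_markov

open Classical in
/-- The messages received by the aggregator: the attacker's for corrupted users (`p.1.1` is the
corrupted set, `p.1.2` the attacker's message vector), the honest ones `p.2` for the others. -/
def overwrite {n : ℕ} {Y : Type*} (p : (Set (Fin n) × (Fin n → Y)) × (Fin n → Y)) : Fin n → Y :=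
  fun i => if i ∈ p.1.1 then p.1.2 i else p.2 i

theorem measurable_overwrite {n : ℕ} {Y : Type*} [MeasurableSpace Y] :
    Measurable (overwrite (n := n) (Y := Y)) := by
  refine measurable_pi_iff.2 fun i => ?_
  refine Measurable.ite ?_ ?_ ?_
  · exact measurableSet_setOfPred.2
      ((measurable_set_mem i).comp (measurable_fst.comp measurable_fst))
  · exact (measurable_pi_apply i).comp (measurable_snd.comp measurable_fst)
  · exact (measurable_pi_apply i).comp measurable_snd

namespace LocalProtocol

variable {n : ℕ} {X S Y Z : Type*} [MeasurableSpace X] [MeasurableSpace S] [MeasurableSpace Y]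
  [MeasurableSpace Z]

/-- `ε`-local differential privacy, for every fixed value of the public string. -/
def IsLDP (Q : LocalProtocol n X S Y Z) (ε : ℝ) : Prop :=
  ∀ (i : Fin n) (x x' : X) (s : S) (E : Set Y), MeasurableSet E →
    Q.randomizer i (x, s) E ≤ ENNReal.ofReal (Real.exp ε) * Q.randomizer i (x', s) E

/-- The honest messages on data `x`, given the public string: independent across users. -/
def honestMessages (Q : LocalProtocol n X S Y Z) (x : Fin n → X) : Kernel S (Fin n → Y) where
  toFun s := Measure.pi fun i => Q.randomizer i (x i, s)
  measurable' := by
    refine Measurable.measure_of_isPiSystem_of_isProbabilityMeasure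
      generateFrom_pi.symm isPiSystem_pi ?_
    rintro _ ⟨t, ht, rfl⟩
    simp only [Measure.pi_pi]
    refine Finset.measurable_prod _ fun i _ => ?_
    exact (Kernel.measurable_coe _ (ht i (Set.mem_univ i))).comp measurable_prodMk_left

instance (Q : LocalProtocol n X S Y Z) (x : Fin n → X) : IsMarkovKernel (Q.honestMessages x) :=
  ⟨fun s => by change IsProbabilityMeasure (Measure.pi _); infer_instance⟩

/-- The messages in the manipulation game on data `x` with attacker `M`, given the public string.
Given that string, the attacker's choices and the honest messages are independent. -/
def manipMessages {m : ℕ} (Q : LocalProtocol n X S Y Z) (x : Fin n → X) (M : Attacker n m S Y) :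
    Kernel S (Fin n → Y) :=
  (M.strategy ×ₖ Q.honestMessages x).map overwrite

instance {m : ℕ} (Q : LocalProtocol n X S Y Z) (x : Fin n → X) (M : Attacker n m S Y) :
    IsMarkovKernel (Q.manipMessages x M) :=
  Kernel.IsMarkovKernel.map _ measurable_overwrite

/-- The distribution of the output of the manipulation game on data `x` with attacker `M`. -/
def manip {m : ℕ} (Q : LocalProtocol n X S Y Z) (x : Fin n → X) (M : Attacker n m S Y) :
    Measure Z :=
  Q.aggregator ∘ₘ ((Q.publicLaw ⊗ₘ Q.manipMessages x M).map Prod.swap)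

instance {m : ℕ} (Q : LocalProtocol n X S Y Z) (x : Fin n → X) (M : Attacker n m S Y) :
    IsProbabilityMeasure (Q.manip x M) := by
  have : IsProbabilityMeasure ((Q.publicLaw ⊗ₘ Q.manipMessages x M).map Prod.swap) :=
    Measure.isProbabilityMeasure_map measurable_swap.aemeasurable
  unfold manip
  infer_instance

/-- The distribution of the output of the manipulation game when the users' data are `n`
independent samples from `D`. -/
def manipIID {m d : ℕ} (Q : LocalProtocol n (Fin d) S Y Z) (D : PMF (Fin d))
    (M : Attacker n m S Y) : Measure Z :=
  (Measure.pi fun _ : Fin n => D.toMeasure).bind fun x => Q.manip x M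

end LocalProtocol

/-- The frequency vector of a dataset. -/
def freq {n d : ℕ} (x : Fin n → Fin d) : Fin d → ℝ :=
  fun j => ((Finset.univ.filter fun i => x i = j).card : ℝ) / n

/-- The `ℓ₁` distance on `ℝ^d`. -/
def l1Dist {d : ℕ} (u v : Fin d → ℝ) : ℝ :=
  ∑ j, |u j - v j|

namespace LocalProtocol

variable {n d : ℕ} {S Y : Type*} [MeasurableSpace S] [MeasurableSpace Y]

/-- Some attacker corrupting at most `m` users forces, on some dataset, `ℓ₁` error at least `α` with
probability at least `1/3`, the quantity to be estimated being the frequency vector of the data. -/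
def ManipulableOnData (Q : LocalProtocol n (Fin d) S Y (Fin d → ℝ)) (m : ℕ) (α : ℝ) : Prop :=
  ∃ (x : Fin n → Fin d) (M : Attacker n m S Y), 1 / 3 ≤ Q.manip x M {z | α ≤ l1Dist z (freq x)}

/-- Some attacker corrupting at most `m` users forces, for some distribution `D` of the users' data,
`ℓ₁` error at least `α` with probability at least `1/3`, the quantity to be estimated being `D`. -/
def ManipulableOnDistribution (Q : LocalProtocol n (Fin d) S Y (Fin d → ℝ)) (m : ℕ) (α : ℝ) :
    Prop :=
  ∃ (D : PMF (Fin d)) (M : Attacker n m S Y),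
    1 / 3 ≤ Q.manipIID D M {z | α ≤ l1Dist z fun j => (D j).toReal}

/-- The largest fraction `m / n` of corrupted users with which accuracy `α` (error less than `α`
with probability greater than `2/3`) is still guaranteed, on every dataset. -/
def breakdownOnData (Q : LocalProtocol n (Fin d) S Y (Fin d → ℝ)) (α : ℝ) : ℝ :=
  sSup {β | ∃ m : ℕ, m ≤ n ∧ ¬ Q.ManipulableOnData m α ∧ β = (m : ℝ) / n}

/-- The largest fraction `m / n` of corrupted users with which accuracy `α` (error less than `α`
with probability greater than `2/3`) is still guaranteed, for every distribution of the data. -/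
def breakdownOnDistribution (Q : LocalProtocol n (Fin d) S Y (Fin d → ℝ)) (α : ℝ) : ℝ :=
  sSup {β | ∃ m : ℕ, m ≤ n ∧ ¬ Q.ManipulableOnDistribution m α ∧ β = (m : ℝ) / n}

/-- The product of the number of possible messages and the number of distinct randomizers. -/
def complexity (Q : LocalProtocol n (Fin d) S Y (Fin d → ℝ)) : ℕ :=
  Nat.card Y * (Set.range Q.randomizer).ncard

end LocalProtocol

end

/-! The attack makes uniform data look like tilted data. Split (most of) `[d]` into `K = ⌊d/2⌋`
pairs, let `U` be uniform on them, and for signs `σ` let `D` move a fraction `t` of the mass inside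
each pair in the direction `σ`. Relative to the message law under `U`, a user with datum from `D`
has message density `1 + t * dev`, where `dev` is a signed average of the densities of the single
data. Privacy confines these densities to `[exp (-ε), exp ε]`, so for random `σ` the value of `dev`
at a fixed message is a Rademacher sum, subgaussian at scale `ε / √d`. A threshold `δ` of order `ε *
√(log N / d)` is therefore rarely crossed, even after a union bound over `N` events.

If `dev ≥ -δ`, then `1 + t * dev = (1 - t * δ) + t * δ * (1 + dev / δ)` is a mixture of the honest
law and a genuine density. So corrupting each user independently with probability `t * δ`, with
messages drawn from density `1 + dev / δ`, turns `U` into `D` (`KernelLDP.smul_tilted_le`,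
`LocalProtocol.exists_attacker_simulating`). Where `dev < -δ` the positive part is taken and
renormalized, and the excess mass is charged to an exponential penalty. Summing the penalty over
users gives `N = n` (`sum_loss_le_of_users`); for finite message spaces, a union over pairs
(randomizer, message) gives `N = |Y| * r` (`sum_loss_le_of_complexity`). By Markov's inequality `m`
corruptions suffice for `t` of order `m / (n * δ)`. The linear functional `pairSign σ` takes the
values `0` on `U` and `t` on `D`, so the output errs by `t / 2` in one of the two games.

For frequencies of a dataset this transfers by Chebyshev only if `t` exceeds a multiple of `1 / √n`.
Below that scale an error of order `1 / √n` is forced without corruption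
(`manipulableOnData_of_resampling`): by privacy, part of the data bits can be resampled without
affecting the messages, and the resulting change is an anticoncentrated lazy walk. For bounded `n`,
one corrupted user already hides its datum. -/

open scoped ENNReal

/-! ### Products of finite mixtures of measures. -/

section FiniteMixtures

variable {ι A Y : Type*} [Fintype ι] [Fintype A] [MeasurableSpace Y]

theorem isFiniteMeasure_sum_smul (c : A → ℝ≥0∞) (hc : ∀ a, c a ≠ ∞) (μ : A → Measure Y)
    [∀ a, IsFiniteMeasure (μ a)] : IsFiniteMeasure (∑ a, c a • μ a) := by
  refine ⟨?_⟩
  simp only [Measure.coe_finsetSum, Measure.coe_smul, Finset.sum_apply, Pi.smul_apply, smul_eq_mul]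
  exact ENNReal.sum_lt_top.2 fun a _ => ENNReal.mul_lt_top (hc a).lt_top (measure_lt_top _ _)

/-- A product of finite mixtures is a mixture of products. -/
theorem pi_sum_smul [DecidableEq ι] (c : ι → A → ℝ≥0∞) (hc : ∀ i a, c i a ≠ ∞)
    (μ : ι → A → Measure Y) [∀ i a, IsFiniteMeasure (μ i a)] :
    Measure.pi (fun i => ∑ a, c i a • μ i a)
      = ∑ x : ι → A, (∏ i, c i (x i)) • Measure.pi fun i => μ i (x i) := by
  have := fun i => isFiniteMeasure_sum_smul (c i) (hc i) (μ i)
  refine Measure.pi_eq fun E _ => ?_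
  simp only [Measure.coe_finsetSum, Measure.coe_smul, Finset.sum_apply, Pi.smul_apply,
    smul_eq_mul, Measure.pi_pi, ← Finset.prod_mul_distrib]
  rw [Finset.prod_univ_sum, Fintype.piFinset_univ]

theorem lintegral_pi_sum_smul [DecidableEq ι] (c : ι → A → ℝ≥0∞) (hc : ∀ i a, c i a ≠ ∞)
    (μ : ι → A → Measure Y) [∀ i a, IsFiniteMeasure (μ i a)] (h : (ι → Y) → ℝ≥0∞) :
    ∫⁻ y, h y ∂(Measure.pi fun i => ∑ a, c i a • μ i a)
      = ∑ x : ι → A, (∏ i, c i (x i)) * ∫⁻ y, h y ∂(Measure.pi fun i => μ i (x i)) := by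
  rw [pi_sum_smul c hc μ, lintegral_finsetSum_measure]
  simp only [lintegral_smul_measure, smul_eq_mul]

/-- A product of measures each dominating a multiple of `ν i` dominates a multiple of the product
of the `ν i`. -/
theorem prod_mul_lintegral_pi_le [DecidableEq ι] (μ ν : ι → Measure Y)
    [∀ i, IsFiniteMeasure (μ i)] [∀ i, IsFiniteMeasure (ν i)] (c : ι → ℝ≥0∞) (hc : ∀ i, c i ≠ ∞)
    (hle : ∀ i, c i • ν i ≤ μ i) (h : (ι → Y) → ℝ≥0∞) :
    (∏ i, c i) * ∫⁻ y, h y ∂(Measure.pi ν) ≤ ∫⁻ y, h y ∂(Measure.pi μ) := by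
  have hf : ∀ i, IsFiniteMeasure (c i • ν i) := fun i => Measure.smul_finite _ (hc i)
  -- Each `μ i` is split as `c i • ν i` plus a remainder. Expanding the product, all terms are
  -- nonnegative and only the one without remainders is kept, so no measurability of `h` is needed.
  let ρ : ι → Bool → Measure Y := fun i b => if b then ν i else μ i - c i • ν i
  have hρ : ∀ i b, IsFiniteMeasure (ρ i b) := by
    intro i b
    cases b <;> simp [ρ] <;> infer_instance
  have hμ : μ = fun i => ∑ b, (if b then c i else 1) • ρ i b := by
    funext i
    simp only [Fintype.sum_bool, ρ, if_true, Bool.false_eq_true, if_false, one_smul]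
    rw [add_comm]
    exact (Measure.sub_add_cancel_of_le (hle i)).symm
  have key := lintegral_pi_sum_smul (fun i (b : Bool) => if b then c i else 1)
    (by intro i b; cases b <;> simp [hc i]) ρ h
  conv_rhs => rw [hμ]
  rw [key]
  refine le_trans ?_ (Finset.single_le_sum (fun _ _ => zero_le) (Finset.mem_univ fun _ => true))
  simp [ρ]

end FiniteMixtures

/-! ### Overwriting honest messages on a fixed corrupted set. -/

section Overwrite

variable {n : ℕ} {Y : Type*} [MeasurableSpace Y]

open Classical in
theorem map_overwrite_prod_pi (C : Set (Fin n)) (μ ν : Fin n → Measure Y)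
    [∀ i, IsProbabilityMeasure (μ i)] [∀ i, IsProbabilityMeasure (ν i)] :
    ((Measure.pi μ).prod (Measure.pi ν)).map (fun q => overwrite ((C, q.1), q.2))
      = Measure.pi fun i => if i ∈ C then μ i else ν i := by
  have hp : ∀ i, IsProbabilityMeasure (if i ∈ C then μ i else ν i) := by
    intro i; split_ifs <;> infer_instance
  have hmeas : Measurable fun q : (Fin n → Y) × (Fin n → Y) => overwrite ((C, q.1), q.2) :=
    measurable_overwrite.comp (by fun_prop)
  refine (Measure.pi_eq fun E hE => ?_).symm
  rw [Measure.map_apply hmeas (MeasurableSet.univ_pi hE)]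
  have : (fun q : (Fin n → Y) × (Fin n → Y) => overwrite ((C, q.1), q.2)) ⁻¹' Set.univ.pi E
      = (Set.univ.pi fun i => if i ∈ C then E i else Set.univ) ×ˢ
        (Set.univ.pi fun i => if i ∈ C then Set.univ else E i) := by
    ext q
    simp only [Set.mem_preimage, Set.mem_pi, Set.mem_univ, true_imp_iff, overwrite, Set.mem_prod,
      ← forall_and]
    refine forall_congr' fun i => ?_
    split_ifs <;> simp
  rw [this, Measure.prod_prod, Measure.pi_pi, Measure.pi_pi, ← Finset.prod_mul_distrib]
  refine Finset.prod_congr rfl fun i _ => ?_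
  split_ifs <;> simp

end Overwrite

/-! ### Output laws and attackers with independent messages. -/

section Manip

variable {n m : ℕ} {X S Y Z : Type*} [MeasurableSpace X] [MeasurableSpace S] [MeasurableSpace Y]
  [MeasurableSpace Z]

theorem LocalProtocol.manip_apply (Q : LocalProtocol n X S Y Z) (x : Fin n → X)
    (M : Attacker n m S Y) {E : Set Z} (hE : MeasurableSet E) :
    Q.manip x M E
      = ∫⁻ s, ∫⁻ y, Q.aggregator (y, s) E ∂(Q.manipMessages x M s) ∂Q.publicLaw := by
  have h1 : Measurable fun q : (Fin n → Y) × S => Q.aggregator q E := Kernel.measurable_coe _ hE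
  rw [LocalProtocol.manip, Measure.bind_apply hE (Kernel.aemeasurable _),
    lintegral_map h1 measurable_swap,
    Measure.lintegral_compProd (f := fun a => Q.aggregator a.swap E) (h1.comp measurable_swap)]
  rfl

/-- The kernel of independent draws from finitely many Markov kernels. -/
noncomputable def piKernel (A : Fin n → Kernel S Y) [∀ i, IsMarkovKernel (A i)] :
    Kernel S (Fin n → Y) where
  toFun s := Measure.pi fun i => A i s
  measurable' := by
    refine Measurable.measure_of_isPiSystem_of_isProbabilityMeasure
      generateFrom_pi.symm isPiSystem_pi ?_
    rintro _ ⟨t, ht, rfl⟩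
    simp only [Measure.pi_pi]
    exact Finset.measurable_prod _ fun i _ => Kernel.measurable_coe _ (ht i (Set.mem_univ i))

theorem piKernel_apply (A : Fin n → Kernel S Y) [∀ i, IsMarkovKernel (A i)] (s : S) :
    piKernel A s = Measure.pi fun i => A i s := rfl

instance (A : Fin n → Kernel S Y) [∀ i, IsMarkovKernel (A i)] : IsMarkovKernel (piKernel A) :=
  ⟨fun s => by rw [piKernel_apply]; infer_instance⟩

/-- An attacker drawing the corrupted set from a finitely supported law `∑ c, w c • δ (T c)`, and
the messages independently from `A i`. -/
noncomputable def mixtureAttacker {Γ : Type*} [Fintype Γ] (w : Γ → ℝ≥0∞) (hw : ∑ c, w c = 1)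
    (T : Γ → Set (Fin n)) (hT : ∀ c, (T c).ncard ≤ m) (A : Fin n → Kernel S Y)
    [∀ i, IsMarkovKernel (A i)] : Attacker n m S Y where
  strategy := Kernel.const S (∑ c, w c • Measure.dirac (T c)) ×ₖ piKernel A
  strategy_markov := by
    have : IsProbabilityMeasure (∑ c, w c • Measure.dirac (T c)) := ⟨by simp [hw]⟩
    infer_instance
  card_le s := by
    have hp : IsProbabilityMeasure (∑ c, w c • Measure.dirac (T c)) := ⟨by simp [hw]⟩
    have hm : MeasurableSet {C : Set (Fin n) | ¬ C.ncard ≤ m} := Set.Finite.measurableSet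
      (Set.toFinite _)
    rw [Kernel.prod_apply, Kernel.const_apply]
    have h0 : ∀ᵐ C ∂(∑ c, w c • Measure.dirac (T c)), C.ncard ≤ m := by
      rw [ae_iff]
      simp only [Measure.coe_finsetSum, Measure.coe_smul, Finset.sum_apply, Pi.smul_apply,
        smul_eq_mul]
      refine Finset.sum_eq_zero fun c _ => ?_
      have h1 : Measure.dirac (T c) {C : Set (Fin n) | ¬ C.ncard ≤ m} = 0 := by
        rw [Measure.dirac_apply' _ hm]
        simp [hT c]
      rw [h1, mul_zero]
    exact Measure.quasiMeasurePreserving_fst.ae h0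

open Classical in
theorem LocalProtocol.lintegral_manipMessages_mixtureAttacker {Γ : Type*} [Fintype Γ]
    (w : Γ → ℝ≥0∞) (hw : ∑ c, w c = 1) (T : Γ → Set (Fin n)) (hT : ∀ c, (T c).ncard ≤ m)
    (A : Fin n → Kernel S Y) [∀ i, IsMarkovKernel (A i)] (Q : LocalProtocol n X S Y Z)
    (x : Fin n → X) (s : S) {h : (Fin n → Y) → ℝ≥0∞} (hh : Measurable h) :
    ∫⁻ y, h y ∂(Q.manipMessages x (mixtureAttacker w hw T hT A) s)
      = ∑ c, w c * ∫⁻ y, h y ∂(Measure.pi fun i =>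
          if i ∈ T c then A i s else Q.randomizer i (x i, s)) := by
  have : IsProbabilityMeasure (∑ c, w c • Measure.dirac (T c)) := ⟨by simp [hw]⟩
  have hho : Measurable fun p : (Set (Fin n) × (Fin n → Y)) × (Fin n → Y) => h (overwrite p) :=
    hh.comp measurable_overwrite
  rw [LocalProtocol.manipMessages, Kernel.map_apply _ measurable_overwrite,
    lintegral_map hh measurable_overwrite, Kernel.prod_apply, lintegral_prod _ hho.aemeasurable]
  simp only [mixtureAttacker]
  rw [Kernel.prod_apply, Kernel.const_apply,
    lintegral_prod _ hho.lintegral_prod_right'.aemeasurable, lintegral_finsetSum_measure]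
  refine Finset.sum_congr rfl fun c _ => ?_
  have hm : Measurable fun q : (Fin n → Y) × (Fin n → Y) => overwrite ((T c, q.1), q.2) :=
    measurable_overwrite.comp (by fun_prop)
  rw [lintegral_smul_measure, smul_eq_mul, lintegral_dirac' _
    hho.lintegral_prod_right'.lintegral_prod_right', ← map_overwrite_prod_pi,
    lintegral_map hh hm, lintegral_prod]
  · rfl
  · exact (hh.comp hm).aemeasurable

theorem LocalProtocol.manipIID_apply {d : ℕ} (Q : LocalProtocol n (Fin d) S Y Z)
    (D : PMF (Fin d)) (M : Attacker n m S Y) {E : Set Z} (hE : MeasurableSet E) :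
    Q.manipIID D M E = ∑ x : Fin n → Fin d, (∏ i, D (x i)) * Q.manip x M E := by
  rw [LocalProtocol.manipIID, Measure.bind_apply hE (measurable_of_countable _).aemeasurable,
    lintegral_fintype]
  refine Finset.sum_congr rfl fun x _ => ?_
  rw [mul_comm, ← Set.univ_pi_singleton, Measure.pi_pi]
  simp only [PMF.toMeasure_apply_singleton _ _ (MeasurableSet.singleton _)]

end Manip

/-! ### Corrupted sets drawn by independent coins. -/

section CoinWeights

variable {n : ℕ}

/-- The probability of the pattern `c` when `n` independent coins of bias `p` are tossed. -/
noncomputable def coinWeight (p : ℝ≥0∞) (c : Fin n → Bool) : ℝ≥0∞ :=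
  ∏ i, if c i then p else 1 - p

theorem sum_coinWeight {p : ℝ≥0∞} (hp : p ≤ 1) : ∑ c : Fin n → Bool, coinWeight p c = 1 := by
  have := Finset.prod_univ_sum (fun _ : Fin n => (Finset.univ : Finset Bool))
    (fun _ b => if b then p else 1 - p)
  rw [Fintype.piFinset_univ] at this
  simp only [coinWeight]
  rw [← this]
  simp [add_tsub_cancel_of_le hp]

theorem sum_coinWeight_mul_apply {p : ℝ≥0∞} (hp : p ≤ 1) (i : Fin n) :
    ∑ c : Fin n → Bool, coinWeight p c * (if c i then 1 else 0) = p := by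
  have := Finset.prod_univ_sum (fun _ : Fin n => (Finset.univ : Finset Bool))
    (fun j b => (if b then p else 1 - p) * (if j = i then (if b then 1 else 0) else 1))
  rw [Fintype.piFinset_univ] at this
  have h2 : ∀ c : Fin n → Bool, coinWeight p c * (if c i then 1 else 0)
      = ∏ j, (if c j then p else 1 - p) * (if j = i then (if c j then 1 else 0) else 1) := by
    intro c
    rw [Finset.prod_mul_distrib, Finset.prod_ite_eq']
    simp [coinWeight]
  rw [Finset.sum_congr rfl fun c _ => h2 c, ← this]
  have h3 : ∀ j : Fin n, (∑ b : Bool, (if b then p else 1 - p) *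
      (if j = i then (if b then 1 else 0) else 1)) = if j = i then p else 1 := by
    intro j
    split_ifs with h <;> simp [add_tsub_cancel_of_le hp]
  rw [Finset.prod_congr rfl fun j _ => h3 j, Finset.prod_ite_eq']
  simp

/-- The corrupted set drawn by tossing coins, replaced by `∅` if it has more than `m` elements. -/
noncomputable def truncatedSet (m : ℕ) (c : Fin n → Bool) : Set (Fin n) :=
  open Classical in if {i | c i = true}.ncard ≤ m then {i | c i = true} else ∅

theorem ncard_truncatedSet_le (m : ℕ) (c : Fin n → Bool) : (truncatedSet m c).ncard ≤ m := by
  unfold truncatedSet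
  split_ifs with h
  · exact h
  · simp

open Classical in
theorem sum_coinWeight_tail_le {p : ℝ≥0∞} (hp : p ≤ 1) {m : ℕ} (hpm : 10 * (n * p) ≤ m) :
    ∑ c : Fin n → Bool, coinWeight p c * (if {i | c i = true}.ncard ≤ m then 0 else 1)
      ≤ 1 / 10 := by
  set t := ∑ c : Fin n → Bool, coinWeight p c * (if {i | c i = true}.ncard ≤ m then 0 else 1)
  -- Markov's inequality: more than `m` heads means at least `m + 1`, and the expected number of
  -- heads is `n * p`.
  have h1 : (m + 1 : ℝ≥0∞) * t ≤ n * p := by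
    calc (m + 1 : ℝ≥0∞) * t
        ≤ ∑ c : Fin n → Bool, coinWeight p c * ∑ i, (if c i then 1 else 0) := by
          rw [Finset.mul_sum]
          refine Finset.sum_le_sum fun c _ => ?_
          rw [mul_left_comm]
          refine mul_le_mul_right ?_ _
          split_ifs with h
          · simp
          · rw [mul_one, Finset.sum_boole]
            rw [not_le, Set.ncard_eq_toFinset_card'] at h
            simp only [Set.toFinset_ofPred] at h
            exact_mod_cast h
      _ = ∑ i : Fin n, ∑ c : Fin n → Bool, coinWeight p c * (if c i then 1 else 0) := by
          simp_rw [Finset.mul_sum]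
          rw [Finset.sum_comm]
      _ = n * p := by simp only [sum_coinWeight_mul_apply hp]; simp
  rw [ENNReal.le_div_iff_mul_le (by simp) (by simp)]
  have h2 : (m + 1 : ℝ≥0∞) * (t * 10) ≤ (m + 1) * 1 := by
    calc (m + 1 : ℝ≥0∞) * (t * 10) = 10 * ((m + 1) * t) := by ring
      _ ≤ 10 * (n * p) := mul_le_mul_right h1 _
      _ ≤ m := hpm
      _ ≤ (m + 1) * 1 := by simp
  exact (ENNReal.mul_le_mul_iff_right (by simp) (by simp)).1 h2

end CoinWeights

/-! ### Simulating one data distribution on another. -/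

namespace LocalProtocol

variable {n d m : ℕ} {S Y Z : Type*} [MeasurableSpace S] [MeasurableSpace Y] [MeasurableSpace Z]

/-- The message law of user `i` when its datum is drawn from `D`. -/
noncomputable def averaged (Q : LocalProtocol n (Fin d) S Y Z) (D : PMF (Fin d)) (i : Fin n)
    (s : S) : Measure Y :=
  ∑ j, D j • Q.randomizer i (j, s)

theorem sum_pmf (D : PMF (Fin d)) : ∑ j, D j = 1 := by
  rw [← tsum_fintype (L := .unconditional _)]
  exact D.tsum_coe

instance (Q : LocalProtocol n (Fin d) S Y Z) (D : PMF (Fin d)) (i : Fin n) (s : S) :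
    IsProbabilityMeasure (Q.averaged D i s) :=
  ⟨by simp [averaged, sum_pmf]⟩

open Classical in
theorem sum_lintegral_pi_ite (Q : LocalProtocol n (Fin d) S Y Z) (D : PMF (Fin d))
    (C : Set (Fin n)) (a : Fin n → Measure Y) [∀ i, IsProbabilityMeasure (a i)] (s : S)
    (h : (Fin n → Y) → ℝ≥0∞) :
    ∑ x : Fin n → Fin d, (∏ i, D (x i)) *
        ∫⁻ y, h y ∂(Measure.pi fun i => if i ∈ C then a i else Q.randomizer i (x i, s))
      = ∫⁻ y, h y ∂(Measure.pi fun i => if i ∈ C then a i else Q.averaged D i s) := by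
  have hf : ∀ (i : Fin n) (j : Fin d),
      IsFiniteMeasure (if i ∈ C then a i else Q.randomizer i (j, s)) := by
    intro i j; split_ifs <;> infer_instance
  rw [← lintegral_pi_sum_smul (fun _ j => D j) (fun _ j => PMF.apply_ne_top D j)
    (fun i j => if i ∈ C then a i else Q.randomizer i (j, s))]
  congr 2
  funext i
  split_ifs
  · rw [← Finset.sum_smul, sum_pmf, one_smul]
  · rfl

/-- The attacker that corrupts nobody. -/
noncomputable def passiveAttacker (m : ℕ) (Q : LocalProtocol n (Fin d) S Y Z) (j : Fin d) :
    Attacker n m S Y :=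
  have (i : Fin n) : IsMarkovKernel ((Q.randomizer i).comap (Prod.mk j) measurable_prodMk_left) :=
    Kernel.IsMarkovKernel.comap _ measurable_prodMk_left
  mixtureAttacker (fun _ : Unit => 1) (by simp) (fun _ => ∅) (by simp)
    (fun i => (Q.randomizer i).comap (Prod.mk j) measurable_prodMk_left)

theorem lintegral_manipMessages_passiveAttacker (Q : LocalProtocol n (Fin d) S Y Z) (j : Fin d)
    (x : Fin n → Fin d) (s : S) {h : (Fin n → Y) → ℝ≥0∞} (hh : Measurable h) :
    ∫⁻ y, h y ∂(Q.manipMessages x (Q.passiveAttacker m j) s)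
      = ∫⁻ y, h y ∂(Measure.pi fun i => Q.randomizer i (x i, s)) := by
  have (i : Fin n) : IsMarkovKernel ((Q.randomizer i).comap (Prod.mk j) measurable_prodMk_left) :=
    Kernel.IsMarkovKernel.comap _ measurable_prodMk_left
  rw [passiveAttacker, lintegral_manipMessages_mixtureAttacker _ _ _ _ _ _ _ _ hh]
  simp

theorem measurable_lintegral_manipMessages (Q : LocalProtocol n (Fin d) S Y Z) (x : Fin n → Fin d)
    (M : Attacker n m S Y) {E : Set Z} (hE : MeasurableSet E) :
    Measurable fun s => ∫⁻ y, Q.aggregator (y, s) E ∂(Q.manipMessages x M s) := by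
  have h1 : Measurable fun q : S × (Fin n → Y) => Q.aggregator q.swap E :=
    (Kernel.measurable_coe _ hE).comp measurable_swap
  exact h1.lintegral_kernel_prod_right'

theorem manipIID_eq_lintegral (Q : LocalProtocol n (Fin d) S Y Z) (D : PMF (Fin d))
    (M : Attacker n m S Y) {E : Set Z} (hE : MeasurableSet E) :
    Q.manipIID D M E = ∫⁻ s, ∑ x : Fin n → Fin d, (∏ i, D (x i)) *
      ∫⁻ y, Q.aggregator (y, s) E ∂(Q.manipMessages x M s) ∂Q.publicLaw := by
  rw [manipIID_apply _ _ _ hE, lintegral_finsetSum _ fun x _ =>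
    (Q.measurable_lintegral_manipMessages x M hE).const_mul _]
  refine Finset.sum_congr rfl fun x _ => ?_
  rw [lintegral_const_mul _ (Q.measurable_lintegral_manipMessages x M hE), manip_apply _ _ _ hE]

theorem measurable_aggregator_apply (Q : LocalProtocol n (Fin d) S Y Z) (s : S) {E : Set Z}
    (hE : MeasurableSet E) : Measurable fun y => Q.aggregator (y, s) E :=
  (Kernel.measurable_coe _ hE).comp measurable_prodMk_right

theorem manipIID_passiveAttacker (Q : LocalProtocol n (Fin d) S Y Z) (D : PMF (Fin d))
    (j : Fin d) {E : Set Z} (hE : MeasurableSet E) :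
    Q.manipIID D (Q.passiveAttacker m j) E
      = ∫⁻ s, ∫⁻ y, Q.aggregator (y, s) E ∂(Measure.pi fun i => Q.averaged D i s)
        ∂Q.publicLaw := by
  classical
  rw [manipIID_eq_lintegral _ _ _ hE]
  refine lintegral_congr fun s => ?_
  have := Q.sum_lintegral_pi_ite D ∅ (fun i => Q.averaged D i s) s fun y => Q.aggregator (y, s) E
  simp only [Set.mem_empty_iff_false, if_false] at this
  rw [← this]
  refine Finset.sum_congr rfl fun x _ => ?_
  rw [lintegral_manipMessages_passiveAttacker _ _ _ _ (Q.measurable_aggregator_apply s hE)]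

/-- If replacing each message, with probability `p`, by one drawn from `A i` turns data drawn from
`U` approximately into data drawn from `D`, then corrupting `10 * n * p` users of a protocol run on
`U` suffices to simulate `D`. -/
theorem exists_attacker_simulating (Q : LocalProtocol n (Fin d) S Y Z) (U D : PMF (Fin d))
    (j₀ : Fin d) (A : Fin n → Kernel S Y) [∀ i, IsMarkovKernel (A i)] {p : ℝ≥0∞} (hp : p ≤ 1)
    (hpm : 10 * (n * p) ≤ m) (L : Fin n → S → ℝ≥0∞) (hL : ∀ i s, L i s ≠ ∞)
    (hdom : ∀ i s, L i s • Q.averaged D i s ≤ (1 - p) • Q.averaged U i s + p • A i s)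
    {η : ℝ≥0∞} (hloss : ∫⁻ s, (1 - ∏ i, L i s) ∂Q.publicLaw ≤ η) :
    ∃ M : Attacker n m S Y, ∀ E : Set Z, MeasurableSet E →
      Q.manipIID D (Q.passiveAttacker m j₀) E ≤ Q.manipIID U M E + 1 / 10 + η := by
  classical
  let M : Attacker n m S Y := mixtureAttacker (coinWeight p) (sum_coinWeight hp)
    (truncatedSet m) (ncard_truncatedSet_le m) A
  refine ⟨M, fun E hE => ?_⟩
  set F : S → ℝ≥0∞ := fun s => ∑ x : Fin n → Fin d, (∏ i, U (x i)) *
      ∫⁻ y, Q.aggregator (y, s) E ∂(Q.manipMessages x M s) with hF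
  have hFm : Measurable F := Finset.measurable_sum _ fun x _ =>
    (Q.measurable_lintegral_manipMessages x M hE).const_mul _
  have key : ∀ s, ∫⁻ y, Q.aggregator (y, s) E ∂(Measure.pi fun i => Q.averaged D i s)
      ≤ F s + 1 / 10 + (1 - ∏ i, L i s) := by
    intro s
    set h : (Fin n → Y) → ℝ≥0∞ := fun y => Q.aggregator (y, s) E
    have hh : Measurable h := Q.measurable_aggregator_apply s hE
    have hle : ∀ (μ : Measure (Fin n → Y)) [IsProbabilityMeasure μ], ∫⁻ y, h y ∂μ ≤ 1 := by
      intro μ _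
      calc ∫⁻ y, h y ∂μ ≤ ∫⁻ _, 1 ∂μ := lintegral_mono fun y => prob_le_one
        _ = 1 := by simp
    have e1 : F s = ∑ c, coinWeight p c * ∫⁻ y, h y ∂(Measure.pi fun i =>
        if i ∈ truncatedSet m c then A i s else Q.averaged U i s) := by
      have e0 : ∀ x, ∫⁻ y, h y ∂(Q.manipMessages x M s) = _ := fun x =>
        lintegral_manipMessages_mixtureAttacker _ _ _ _ _ Q x s hh
      simp only [F]
      rw [Finset.sum_congr rfl fun x _ => by rw [e0 x, Finset.mul_sum], Finset.sum_comm]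
      refine Finset.sum_congr rfl fun c _ => ?_
      rw [← Q.sum_lintegral_pi_ite U (truncatedSet m c) (fun i => A i s) s h, Finset.mul_sum]
      exact Finset.sum_congr rfl fun x _ => mul_left_comm _ _ _
    have e2 : ∑ c, coinWeight p c * ∫⁻ y, h y ∂(Measure.pi fun i =>
        if c i then A i s else Q.averaged U i s) ≤ F s + 1 / 10 := by
      refine le_trans ?_ (add_le_add_right (sum_coinWeight_tail_le hp hpm) _)
      rw [e1, ← Finset.sum_add_distrib]
      refine Finset.sum_le_sum fun c _ => ?_
      rw [← mul_add]
      refine mul_le_mul_right ?_ _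
      -- A pattern with too many heads is replaced by `∅`; as integrals of `h` are at most `1`, it
      -- costs at most its own weight.
      by_cases hc : {i | c i = true}.ncard ≤ m
      · simp [truncatedSet, hc]
      · have (i : Fin n) : IsProbabilityMeasure (if c i then A i s else Q.averaged U i s) := by
          split_ifs <;> infer_instance
        simp only [hc, if_false]
        exact (hle _).trans le_add_self
    -- Independence of the coins matters here: averaging the products over all patterns gives the
    -- product of the per-user mixtures.
    have e3 : ∑ c, coinWeight p c * ∫⁻ y, h y ∂(Measure.pi fun i =>
        if c i then A i s else Q.averaged U i s)
        = ∫⁻ y, h y ∂(Measure.pi fun i => (1 - p) • Q.averaged U i s + p • A i s) := by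
      have hf : ∀ (i : Fin n) (b : Bool),
          IsFiniteMeasure (if b then A i s else Q.averaged U i s) := by
        intro i b; split_ifs <;> infer_instance
      have hp' : p ≠ ∞ := ne_top_of_le_ne_top ENNReal.one_ne_top hp
      have := lintegral_pi_sum_smul (fun (_ : Fin n) (b : Bool) => if b then p else 1 - p)
        (by intro i b; cases b <;> simp [hp'])
        (fun i b => if b then A i s else Q.averaged U i s) h
      simp only [Fintype.sum_bool, if_true, Bool.false_eq_true, if_false] at this
      simp only [coinWeight]
      rw [← this]
      simp only [add_comm]
    have hpm' : ∀ i, IsFiniteMeasure ((1 - p) • Q.averaged U i s + p • A i s) := by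
      intro i
      have := Measure.smul_finite (Q.averaged U i s) (c := 1 - p) (by simp)
      have := Measure.smul_finite (A i s) (c := p) (ne_top_of_le_ne_top ENNReal.one_ne_top hp)
      infer_instance
    have e4 := prod_mul_lintegral_pi_le
      (fun i => (1 - p) • Q.averaged U i s + p • A i s) (fun i => Q.averaged D i s)
      (fun i => L i s) (fun i => hL i s) (fun i => hdom i s) h
    set I := ∫⁻ y, h y ∂(Measure.pi fun i => Q.averaged D i s)
    calc I = 1 * I := (one_mul _).symm
      _ ≤ (∏ i, L i s + (1 - ∏ i, L i s)) * I := mul_le_mul_left le_add_tsub _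
      _ = (∏ i, L i s) * I + (1 - ∏ i, L i s) * I := add_mul _ _ _
      _ ≤ (F s + 1 / 10) + (1 - ∏ i, L i s) * 1 :=
        add_le_add (e4.trans (e3 ▸ e2)) (mul_le_mul_right (hle _) _)
      _ = F s + 1 / 10 + (1 - ∏ i, L i s) := by rw [mul_one]
  rw [manipIID_passiveAttacker _ _ _ hE, manipIID_eq_lintegral _ _ _ hE]
  refine (lintegral_mono key).trans ?_
  rw [lintegral_add_left (hFm.add_const _), lintegral_add_right _ measurable_const]
  simp only [lintegral_const, measure_univ, mul_one]
  exact add_le_add_right hloss _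

end LocalProtocol

/-! ### The paired design and its tilted distributions. -/

section PairedDesign

/-- The embedding of `⌊d/2⌋` disjoint pairs into `Fin d`. -/
def pairIndex (d : ℕ) (q : Fin (d / 2) × Bool) : Fin d :=
  ⟨2 * q.1 + q.2.toNat, by
    have := q.1.2
    have := Bool.toNat_le q.2
    omega⟩

theorem pairIndex_injective (d : ℕ) : Function.Injective (pairIndex d) := by
  rintro ⟨k, b⟩ ⟨k', b'⟩ h
  simp only [pairIndex, Fin.mk.injEq] at h
  have h1 : (k : ℕ) = k' := by
    have := Bool.toNat_le b
    have := Bool.toNat_le b'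
    omega
  have h2 : b = b' := by
    cases b <;> cases b' <;> simp at h ⊢ <;> omega
  exact Prod.ext (Fin.ext h1) h2

/-- The sign `±1` of a Boolean. -/
def boolSign (b : Bool) : ℝ := if b then 1 else -1

theorem abs_boolSign (b : Bool) : |boolSign b| = 1 := by cases b <;> simp [boolSign]

theorem boolSign_mul_self (b : Bool) : boolSign b * boolSign b = 1 := by
  cases b <;> simp [boolSign]

/-- The uniform weights on the `2⌊d/2⌋` paired elements of `Fin d`. -/
noncomputable def pairWeight (d : ℕ) : Fin d → ℝ :=
  Function.extend (pairIndex d) (fun _ => 1 / (2 * (d / 2 : ℕ))) 0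

/-- The sign pattern on `Fin d` with value `±σ k` on the `k`-th pair. -/
noncomputable def pairSign {d : ℕ} (σ : Fin (d / 2) → Bool) : Fin d → ℝ :=
  Function.extend (pairIndex d) (fun q => boolSign (σ q.1) * boolSign q.2) 0

variable {d : ℕ}

theorem pairWeight_pairIndex (q : Fin (d / 2) × Bool) :
    pairWeight d (pairIndex d q) = 1 / (2 * (d / 2 : ℕ)) :=
  (pairIndex_injective d).extend_apply _ _ _

theorem pairSign_pairIndex (σ : Fin (d / 2) → Bool) (q : Fin (d / 2) × Bool) :
    pairSign σ (pairIndex d q) = boolSign (σ q.1) * boolSign q.2 :=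
  (pairIndex_injective d).extend_apply _ _ _

theorem sum_pairWeight_mul (f : Fin d → ℝ) :
    ∑ j, pairWeight d j * f j
      = ∑ q : Fin (d / 2) × Bool, 1 / (2 * (d / 2 : ℕ)) * f (pairIndex d q) := by
  refine (Fintype.sum_of_injective (pairIndex d) (pairIndex_injective d) _ _ ?_ ?_).symm
  · intro j hj
    rw [pairWeight, Function.extend_apply' _ _ _ (by simpa using hj)]
    simp
  · intro q
    rw [pairWeight_pairIndex]

theorem pairWeight_nonneg (j : Fin d) : 0 ≤ pairWeight d j := by
  by_cases h : ∃ q, pairIndex d q = j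
  · obtain ⟨q, rfl⟩ := h
    rw [pairWeight_pairIndex]
    positivity
  · rw [pairWeight, Function.extend_apply' _ _ _ h]
    simp

theorem abs_pairSign_le (σ : Fin (d / 2) → Bool) (j : Fin d) : |pairSign σ j| ≤ 1 := by
  by_cases h : ∃ q, pairIndex d q = j
  · obtain ⟨q, rfl⟩ := h
    rw [pairSign_pairIndex, abs_mul, abs_boolSign, abs_boolSign, one_mul]
  · rw [pairSign, Function.extend_apply' _ _ _ h]
    simp

theorem sum_pairWeight (hd : 2 ≤ d) : ∑ j, pairWeight d j = 1 := by
  have := sum_pairWeight_mul (d := d) fun _ => 1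
  simp only [mul_one] at this
  have hK : ((d / 2 : ℕ) : ℝ) ≠ 0 := by
    have : 0 < d / 2 := by omega
    positivity
  rw [this]
  simp only [Finset.sum_const, Finset.card_univ, Fintype.card_prod, Fintype.card_fin,
    Fintype.card_bool, nsmul_eq_mul]
  push_cast
  field_simp

theorem sum_pairWeight_mul_pairSign (σ : Fin (d / 2) → Bool) :
    ∑ j, pairWeight d j * pairSign σ j = 0 := by
  rw [sum_pairWeight_mul, Fintype.sum_prod_type]
  refine Finset.sum_eq_zero fun k _ => ?_
  simp [pairSign_pairIndex, boolSign]

theorem sum_pairWeight_mul_pairSign_sq (hd : 2 ≤ d) (σ : Fin (d / 2) → Bool) :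
    ∑ j, pairWeight d j * (pairSign σ j * pairSign σ j) = 1 := by
  rw [← sum_pairWeight hd, sum_pairWeight_mul]
  have := sum_pairWeight_mul (d := d) fun _ => 1
  simp only [mul_one] at this
  rw [this]
  refine Finset.sum_congr rfl fun q _ => ?_
  rw [pairSign_pairIndex]
  have h1 := boolSign_mul_self (σ q.1)
  have h2 := boolSign_mul_self q.2
  have : boolSign (σ q.1) * boolSign q.2 * (boolSign (σ q.1) * boolSign q.2) = 1 := by
    linear_combination boolSign q.2 * boolSign q.2 * h1 + h2
  rw [this, mul_one]

/-- Moment generating function of a random signed sum of pair differences. -/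
theorem sum_exp_pairSign_le {f : Fin d → ℝ} {lo η : ℝ} (h1 : ∀ j, lo ≤ f j)
    (h2 : ∀ j, f j ≤ lo + 2 * η) (θ : ℝ) :
    ∑ σ : Fin (d / 2) → Bool, Real.exp (-θ * ∑ j, pairWeight d j * (pairSign σ j * f j))
      ≤ 2 ^ (d / 2) * Real.exp (θ ^ 2 * η ^ 2 / (2 * (d / 2 : ℕ))) := by
  set K := d / 2
  let a : Fin K → ℝ := fun k => (f (pairIndex d (k, true)) - f (pairIndex d (k, false))) / (2 * K)
  have e1 : ∀ σ : Fin K → Bool, Real.exp (-θ * ∑ j, pairWeight d j * (pairSign σ j * f j))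
      = ∏ k, Real.exp (-θ * (boolSign (σ k) * a k)) := by
    intro σ
    rw [← Real.exp_sum, sum_pairWeight_mul, Fintype.sum_prod_type, Finset.mul_sum]
    congr 1
    refine Finset.sum_congr rfl fun k _ => ?_
    simp only [Fintype.sum_bool, pairSign_pairIndex, a]
    simp only [boolSign, if_true, Bool.false_eq_true, if_false, K]
    ring
  have e2 := Finset.prod_univ_sum (fun _ : Fin K => (Finset.univ : Finset Bool))
    (fun k b => Real.exp (-θ * (boolSign b * a k)))
  rw [Fintype.piFinset_univ] at e2
  rw [Finset.sum_congr rfl fun σ _ => e1 σ, ← e2]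
  -- The signs are independent, which leaves one `cosh` per pair. The difference in a pair is at
  -- most `2 * η` and has weight `1 / (2 * K)`, so `cosh x ≤ exp (x ^ 2 / 2)` applies with `|a k| ≤
  -- η / K`.
  have e3 : ∀ k : Fin K, ∑ b, Real.exp (-θ * (boolSign b * a k))
      ≤ 2 * Real.exp (θ ^ 2 * η ^ 2 / (2 * K) / K) := by
    intro k
    have hK : (0 : ℝ) < K := by
      have := k.pos
      exact_mod_cast this
    have e4 : ∑ b, Real.exp (-θ * (boolSign b * a k)) = 2 * Real.cosh (θ * a k) := by
      rw [Real.cosh_eq]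
      simp only [Fintype.sum_bool, boolSign, if_true, Bool.false_eq_true, if_false]
      ring_nf
    rw [e4]
    refine mul_le_mul_of_nonneg_left ((Real.cosh_le_exp_half_sq _).trans ?_) (by norm_num)
    rw [Real.exp_le_exp]
    have ha : |a k| ≤ η / K := by
      simp only [a]
      rw [abs_div, abs_of_pos (by positivity : (0 : ℝ) < 2 * K), div_le_div_iff₀ (by positivity) hK]
      have : |f (pairIndex d (k, true)) - f (pairIndex d (k, false))| ≤ 2 * η := by
        rw [abs_le]
        constructor <;>
          linarith [h1 (pairIndex d (k, true)), h1 (pairIndex d (k, false)),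
            h2 (pairIndex d (k, true)), h2 (pairIndex d (k, false))]
      nlinarith
    have ha2 : a k ^ 2 ≤ (η / K) ^ 2 := by
      rw [← sq_abs]
      exact pow_le_pow_left₀ (abs_nonneg _) ha 2
    calc (θ * a k) ^ 2 / 2 = θ ^ 2 * a k ^ 2 / 2 := by ring
      _ ≤ θ ^ 2 * (η / K) ^ 2 / 2 := by gcongr
      _ = θ ^ 2 * η ^ 2 / (2 * K) / K := by field_simp
  refine (Finset.prod_le_prod (fun k _ => Finset.sum_nonneg fun _ _ => (Real.exp_pos _).le)
    fun k _ => e3 k).trans ?_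
  rw [Finset.prod_const, Finset.card_univ, Fintype.card_fin, mul_pow, ← Real.exp_nat_mul]
  rcases Nat.eq_zero_or_pos K with h0 | h0
  · have h0' : d / 2 = 0 := h0
    simp [h0, h0']
  · have : (K : ℝ) ≠ 0 := by positivity
    rw [mul_div_cancel₀ _ this]

theorem tilted_nonneg (σ : Fin (d / 2) → Bool) {t : ℝ} (ht : 0 ≤ t) (ht' : t ≤ 1) (j : Fin d) :
    0 ≤ pairWeight d j * (1 + t * pairSign σ j) := by
  refine mul_nonneg (pairWeight_nonneg j) ?_
  have := (abs_le.1 (abs_pairSign_le σ j)).1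
  nlinarith

theorem sum_tilted (hd : 2 ≤ d) (σ : Fin (d / 2) → Bool) (t : ℝ) :
    ∑ j, pairWeight d j * (1 + t * pairSign σ j) = 1 := by
  have e : ∀ j, pairWeight d j * (1 + t * pairSign σ j)
      = pairWeight d j + t * (pairWeight d j * pairSign σ j) := fun j => by ring
  simp_rw [e]
  rw [Finset.sum_add_distrib, ← Finset.mul_sum, sum_pairWeight hd, sum_pairWeight_mul_pairSign]
  ring

/-- The uniform distribution on the paired elements. -/
noncomputable def pairUniform (hd : 2 ≤ d) : PMF (Fin d) :=
  PMF.ofFintype (fun j => ENNReal.ofReal (pairWeight d j)) (by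
    rw [← ENNReal.ofReal_sum_of_nonneg fun j _ => pairWeight_nonneg j, sum_pairWeight hd]
    simp)

/-- The distribution obtained by moving, in each pair, a fraction `t` of the mass in the direction
prescribed by `σ`. -/
noncomputable def tiltedPMF (hd : 2 ≤ d) (σ : Fin (d / 2) → Bool) {t : ℝ} (ht : 0 ≤ t)
    (ht' : t ≤ 1) : PMF (Fin d) :=
  PMF.ofFintype (fun j => ENNReal.ofReal (pairWeight d j * (1 + t * pairSign σ j))) (by
    rw [← ENNReal.ofReal_sum_of_nonneg fun j _ => tilted_nonneg σ ht ht' j, sum_tilted hd]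
    simp)

theorem pairUniform_apply (hd : 2 ≤ d) (j : Fin d) :
    pairUniform hd j = ENNReal.ofReal (pairWeight d j) := rfl

theorem tiltedPMF_apply (hd : 2 ≤ d) (σ : Fin (d / 2) → Bool) {t : ℝ} (ht : 0 ≤ t)
    (ht' : t ≤ 1) (j : Fin d) :
    tiltedPMF hd σ ht ht' j = ENNReal.ofReal (pairWeight d j * (1 + t * pairSign σ j)) := rfl

/-- The linear functional with coefficients `ψ`. -/
def contrast (ψ z : Fin d → ℝ) : ℝ := ∑ j, ψ j * z j

theorem measurable_contrast (ψ : Fin d → ℝ) : Measurable (contrast ψ) := by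
  unfold contrast
  fun_prop

/-- Duality of `ℓ₁` and `ℓ∞`: lower bounds on the `ℓ₁` error reduce to a single linear functional.
-/
theorem abs_contrast_sub_le {ψ : Fin d → ℝ} (hψ : ∀ j, |ψ j| ≤ 1) (z w : Fin d → ℝ) :
    |contrast ψ z - contrast ψ w| ≤ l1Dist z w := by
  rw [contrast, contrast, ← Finset.sum_sub_distrib]
  refine (Finset.abs_sum_le_sum_abs _ _).trans (Finset.sum_le_sum fun j _ => ?_)
  rw [← mul_sub, abs_mul]
  exact mul_le_of_le_one_left (abs_nonneg _) (hψ j)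

theorem contrast_pairUniform (hd : 2 ≤ d) (σ : Fin (d / 2) → Bool) :
    contrast (pairSign σ) (fun j => (pairUniform hd j).toReal) = 0 := by
  rw [contrast, ← sum_pairWeight_mul_pairSign σ]
  refine Finset.sum_congr rfl fun j _ => ?_
  rw [pairUniform_apply, ENNReal.toReal_ofReal (pairWeight_nonneg j), mul_comm]

theorem contrast_tiltedPMF (hd : 2 ≤ d) (σ : Fin (d / 2) → Bool) {t : ℝ} (ht : 0 ≤ t)
    (ht' : t ≤ 1) :
    contrast (pairSign σ) (fun j => (tiltedPMF hd σ ht ht' j).toReal) = t := by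
  have e : ∀ j, pairSign σ j * (tiltedPMF hd σ ht ht' j).toReal
      = pairWeight d j * pairSign σ j + t * (pairWeight d j * (pairSign σ j * pairSign σ j)) := by
    intro j
    rw [tiltedPMF_apply, ENNReal.toReal_ofReal (tilted_nonneg σ ht ht' j)]
    ring
  rw [contrast, Finset.sum_congr rfl fun j _ => e j, Finset.sum_add_distrib, ← Finset.mul_sum,
    sum_pairWeight_mul_pairSign, sum_pairWeight_mul_pairSign_sq hd]
  ring

end PairedDesign

/-! ### Message densities under local privacy. -/

section Density

variable {d : ℕ} {S Y : Type*} [MeasurableSpace S] [MeasurableSpace Y]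

/-- The law under `κ` of the message for a datum drawn uniformly from the paired elements. -/
noncomputable def baseKernel (hd : 2 ≤ d) (κ : Kernel (Fin d × S) Y) : Kernel S Y where
  toFun s := ∑ j, pairUniform hd j • κ (j, s)
  measurable' := by
    refine Measure.measurable_of_measurable_coe _ fun E hE => ?_
    simp only [Measure.coe_finsetSum, Measure.coe_smul, Finset.sum_apply, Pi.smul_apply,
      smul_eq_mul]
    exact Finset.measurable_sum _ fun j _ =>
      ((Kernel.measurable_coe κ hE).comp measurable_prodMk_left).const_mul _

theorem baseKernel_apply (hd : 2 ≤ d) (κ : Kernel (Fin d × S) Y) (s : S) :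
    baseKernel hd κ s = ∑ j, pairUniform hd j • κ (j, s) := rfl

theorem baseKernel_apply' (hd : 2 ≤ d) (κ : Kernel (Fin d × S) Y) (s : S) (E : Set Y) :
    baseKernel hd κ s E = ∑ j, pairUniform hd j * κ (j, s) E := by
  simp [baseKernel_apply]

instance (hd : 2 ≤ d) (κ : Kernel (Fin d × S) Y) [IsMarkovKernel κ] :
    IsMarkovKernel (baseKernel hd κ) :=
  ⟨fun s => ⟨by simp [baseKernel_apply', LocalProtocol.sum_pmf]⟩⟩

/-- The message law of `κ` for the datum `j`. -/
noncomputable def fiberKernel (κ : Kernel (Fin d × S) Y) (j : Fin d) : Kernel S Y :=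
  κ.comap (Prod.mk j) measurable_prodMk_left

instance (κ : Kernel (Fin d × S) Y) [IsMarkovKernel κ] (j : Fin d) :
    IsMarkovKernel (fiberKernel κ j) :=
  Kernel.IsMarkovKernel.comap _ measurable_prodMk_left

theorem fiberKernel_apply (κ : Kernel (Fin d × S) Y) (j : Fin d) (s : S) :
    fiberKernel κ j s = κ (j, s) := rfl

variable {hd : 2 ≤ d} {ε : ℝ} {κ : Kernel (Fin d × S) Y}

/-- Local privacy of a single randomizer. -/
def KernelLDP (ε : ℝ) (κ : Kernel (Fin d × S) Y) : Prop :=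
  ∀ (x x' : Fin d) (s : S) (E : Set Y), MeasurableSet E →
    κ (x, s) E ≤ ENNReal.ofReal (Real.exp ε) * κ (x', s) E

theorem KernelLDP.le_baseKernel (h : KernelLDP ε κ) (j : Fin d) (s : S) {E : Set Y}
    (hE : MeasurableSet E) :
    κ (j, s) E ≤ ENNReal.ofReal (Real.exp ε) * baseKernel hd κ s E := by
  rw [baseKernel_apply', Finset.mul_sum]
  calc κ (j, s) E = ∑ i, pairUniform hd i * κ (j, s) E := by
        rw [← Finset.sum_mul, LocalProtocol.sum_pmf, one_mul]
    _ ≤ _ := Finset.sum_le_sum fun i _ => by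
        rw [mul_left_comm]
        exact mul_le_mul_right (h j i s E hE) _

theorem KernelLDP.baseKernel_le (h : KernelLDP ε κ) (j : Fin d) (s : S) {E : Set Y}
    (hE : MeasurableSet E) :
    baseKernel hd κ s E ≤ ENNReal.ofReal (Real.exp ε) * κ (j, s) E := by
  rw [baseKernel_apply']
  calc ∑ i, pairUniform hd i * κ (i, s) E
      ≤ ∑ i, pairUniform hd i * (ENNReal.ofReal (Real.exp ε) * κ (j, s) E) :=
        Finset.sum_le_sum fun i _ => mul_le_mul_right (h i j s E hE) _
    _ = _ := by rw [← Finset.sum_mul, LocalProtocol.sum_pmf, one_mul]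

theorem KernelLDP.absolutelyContinuous (h : KernelLDP ε κ) (j : Fin d) (s : S) :
    fiberKernel κ j s ≪ baseKernel hd κ s := by
  refine Measure.AbsolutelyContinuous.mk fun E hE h0 => ?_
  have := h.le_baseKernel (hd := hd) j s hE
  rw [h0, mul_zero] at this
  exact le_antisymm this zero_le

variable [MeasurableSpace.CountableOrCountablyGenerated S Y]

/-- The density of the message law for the datum `j` with respect to `baseKernel`, truncated to
`[exp (-ε), exp ε]`. -/
noncomputable def dens (hd : 2 ≤ d) (ε : ℝ) (κ : Kernel (Fin d × S) Y) (j : Fin d) (s : S) (y : Y) :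
    ℝ :=
  max (Real.exp (-ε))
    (min (Real.exp ε) (Kernel.rnDeriv (fiberKernel κ j) (baseKernel hd κ) s y).toReal)

theorem measurable_dens (hd : 2 ≤ d) (ε : ℝ) (κ : Kernel (Fin d × S) Y) (j : Fin d) :
    Measurable fun q : S × Y => dens hd ε κ j q.1 q.2 := by
  unfold dens
  have := Kernel.measurable_rnDeriv (fiberKernel κ j) (baseKernel hd κ)
  exact measurable_const.max (measurable_const.min this.ennreal_toReal)

theorem exp_neg_le_dens (j : Fin d) (s : S) (y : Y) : Real.exp (-ε) ≤ dens hd ε κ j s y :=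
  le_max_left _ _

theorem dens_le_exp (hε : 0 ≤ ε) (j : Fin d) (s : S) (y : Y) : dens hd ε κ j s y ≤ Real.exp ε :=
  max_le (Real.exp_le_exp.2 (by linarith)) (min_le_left _ _)

theorem dens_nonneg (j : Fin d) (s : S) (y : Y) : 0 ≤ dens hd ε κ j s y :=
  (Real.exp_pos _).le.trans (exp_neg_le_dens j s y)

/-- The relative deviation, caused by the sign pattern `σ`, of the message density from
`baseKernel`. -/
noncomputable def dev (hd : 2 ≤ d) (ε : ℝ) (κ : Kernel (Fin d × S) Y) (σ : Fin (d / 2) → Bool)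
    (s : S) (y : Y) : ℝ :=
  ∑ j, pairWeight d j * (pairSign σ j * dens hd ε κ j s y)

theorem measurable_dev (hd : 2 ≤ d) (ε : ℝ) (κ : Kernel (Fin d × S) Y) (σ : Fin (d / 2) → Bool) :
    Measurable fun q : S × Y => dev hd ε κ σ q.1 q.2 :=
  Finset.measurable_sum _ fun j _ => ((measurable_dens hd ε κ j).const_mul _).const_mul _

variable [IsMarkovKernel κ]

/-- Privacy squeezes the law of each datum between `exp (-ε)` and `exp ε` times the average law on
every event, so the clamping in `dens` is inactive almost everywhere. What clamping provides is
bounds valid at every message, as needed for estimates pointwise in `y`. -/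
theorem KernelLDP.dens_ae_eq (h : KernelLDP ε κ) (j : Fin d) (s : S) :
    ∀ᵐ y ∂(baseKernel hd κ s), ENNReal.ofReal (dens hd ε κ j s y)
      = Kernel.rnDeriv (fiberKernel κ j) (baseKernel hd κ) s y := by
  set f := Kernel.rnDeriv (fiberKernel κ j) (baseKernel hd κ) s with hf
  have hfm : Measurable f := Kernel.measurable_rnDeriv_right _ _ s
  have hint : ∀ E, MeasurableSet E → ∫⁻ y in E, f y ∂(baseKernel hd κ s) = κ (j, s) E :=
    fun E hE => Kernel.setLIntegral_rnDeriv (h.absolutelyContinuous j s) hE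
  have hub : f ≤ᵐ[baseKernel hd κ s] fun _ => ENNReal.ofReal (Real.exp ε) := by
    refine ae_le_of_forall_setLIntegral_le_of_sigmaFinite hfm fun E hE _ => ?_
    rw [hint E hE, lintegral_const, Measure.restrict_apply_univ]
    exact h.le_baseKernel j s hE
  have hlb : (fun _ => ENNReal.ofReal (Real.exp (-ε))) ≤ᵐ[baseKernel hd κ s] f := by
    refine ae_le_of_forall_setLIntegral_le_of_sigmaFinite measurable_const fun E hE _ => ?_
    rw [hint E hE, lintegral_const, Measure.restrict_apply_univ]
    refine (mul_le_mul_right (h.baseKernel_le j s hE) _).trans ?_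
    rw [← mul_assoc, ← ENNReal.ofReal_mul (Real.exp_pos _).le, ← Real.exp_add]
    simp
  filter_upwards [hub, hlb] with y h1 h2
  have hft : f y ≠ ∞ := ne_top_of_le_ne_top ENNReal.ofReal_ne_top h1
  have h1' : (f y).toReal ≤ Real.exp ε :=
    ENNReal.toReal_le_of_le_ofReal (Real.exp_pos _).le h1
  have h2' : Real.exp (-ε) ≤ (f y).toReal := (ENNReal.ofReal_le_iff_le_toReal hft).1 h2
  rw [dens, ← hf, min_eq_right h1', max_eq_right h2', ENNReal.ofReal_toReal hft]

theorem KernelLDP.withDensity_dens (h : KernelLDP ε κ) (j : Fin d) (s : S) :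
    (baseKernel hd κ s).withDensity (fun y => ENNReal.ofReal (dens hd ε κ j s y)) = κ (j, s) := by
  rw [withDensity_congr_ae (h.dens_ae_eq j s), ← fiberKernel_apply κ j s,
    ← Kernel.withDensity_rnDeriv_eq (h.absolutelyContinuous (hd := hd) j s),
    Kernel.withDensity_apply _ (Kernel.measurable_rnDeriv _ _)]

theorem KernelLDP.withDensity_sum (h : KernelLDP ε κ) (w : Fin d → ℝ) (hw : ∀ j, 0 ≤ w j) (s : S) :
    (baseKernel hd κ s).withDensity (fun y => ENNReal.ofReal (∑ j, w j * dens hd ε κ j s y))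
      = ∑ j, ENNReal.ofReal (w j) • κ (j, s) := by
  have hm : ∀ j, Measurable fun y => ENNReal.ofReal (dens hd ε κ j s y) := fun j =>
    ((measurable_dens hd ε κ j).comp measurable_prodMk_left).ennreal_ofReal
  ext E hE
  rw [withDensity_apply _ hE]
  have e : ∀ y, ENNReal.ofReal (∑ j, w j * dens hd ε κ j s y)
      = ∑ j, ENNReal.ofReal (w j) * ENNReal.ofReal (dens hd ε κ j s y) := by
    intro y
    rw [ENNReal.ofReal_sum_of_nonneg fun j _ => mul_nonneg (hw j) (dens_nonneg j s y)]
    exact Finset.sum_congr rfl fun j _ => ENNReal.ofReal_mul (hw j)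
  simp_rw [e]
  rw [lintegral_finsetSum _ fun j _ => (hm j).const_mul _]
  simp only [Measure.coe_finsetSum, Measure.coe_smul, Finset.sum_apply, Pi.smul_apply, smul_eq_mul]
  refine Finset.sum_congr rfl fun j _ => ?_
  rw [lintegral_const_mul _ (hm j), ← withDensity_apply _ hE, h.withDensity_dens j s]

/-- The average of the densities and the constant `1` are both densities of `baseKernel` with
respect to itself. -/
theorem KernelLDP.sum_pairWeight_mul_dens (h : KernelLDP ε κ) (s : S) :
    ∀ᵐ y ∂(baseKernel hd κ s), ∑ j, pairWeight d j * dens hd ε κ j s y = 1 := by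
  have hm : Measurable fun y => ENNReal.ofReal (∑ j, pairWeight d j * dens hd ε κ j s y) :=
    (Finset.measurable_sum _ fun j _ =>
      ((measurable_dens hd ε κ j).comp measurable_prodMk_left).const_mul _).ennreal_ofReal
  have h1 := h.withDensity_sum (hd := hd) (pairWeight d) pairWeight_nonneg s
  have h2 : (baseKernel hd κ s).withDensity
      (fun y => ENNReal.ofReal (∑ j, pairWeight d j * dens hd ε κ j s y))
      = (baseKernel hd κ s).withDensity 1 := by
    rw [h1, withDensity_one]
    rfl
  rw [withDensity_eq_iff_of_sigmaFinite hm.aemeasurable measurable_one.aemeasurable] at h2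
  filter_upwards [h2] with y hy
  simpa using hy

theorem integrable_of_measurable_of_bounded {μ : Measure Y} [IsFiniteMeasure μ] {f : Y → ℝ} {C : ℝ}
    (hf : Measurable f) (hC : ∀ y, |f y| ≤ C) : Integrable f μ :=
  Integrable.of_bound hf.aestronglyMeasurable C (ae_of_all _ hC)

theorem KernelLDP.integral_dens (h : KernelLDP ε κ) (j : Fin d) (s : S) :
    ∫ y, dens hd ε κ j s y ∂(baseKernel hd κ s) = 1 := by
  rw [integral_eq_lintegral_of_nonneg_ae (ae_of_all _ fun y => dens_nonneg j s y)
    ((measurable_dens hd ε κ j).comp measurable_prodMk_left).aestronglyMeasurable]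
  have := congrArg (fun μ : Measure Y => μ Set.univ) (h.withDensity_dens (hd := hd) j s)
  simp only [withDensity_apply _ MeasurableSet.univ, Measure.restrict_univ, measure_univ] at this
  rw [this]
  simp

end Density

/-- The union bound for independent events of probabilities `c i`. -/
theorem one_le_prod_add_sum {ι : Type*} (s : Finset ι) (c : ι → ℝ≥0∞) (hc : ∀ i, c i ≤ 1) :
    1 ≤ ∏ i ∈ s, c i + ∑ i ∈ s, (1 - c i) := by
  classical
  induction s using Finset.induction_on with
  | empty => simp
  | insert a s ha ih =>
    rw [Finset.prod_insert ha, Finset.sum_insert ha]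
    calc (1 : ℝ≥0∞) = c a * 1 + (1 - c a) := by rw [mul_one, add_tsub_cancel_of_le (hc a)]
      _ ≤ c a * (∏ i ∈ s, c i + ∑ i ∈ s, (1 - c i)) + (1 - c a) := by gcongr
      _ = c a * ∏ i ∈ s, c i + c a * ∑ i ∈ s, (1 - c i) + (1 - c a) := by rw [mul_add]
      _ ≤ c a * ∏ i ∈ s, c i + 1 * ∑ i ∈ s, (1 - c i) + (1 - c a) := by gcongr; exact hc a
      _ = _ := by ring

/-- The union bound above, together with `1 - M⁻¹ ≤ M - 1` for `M ≥ 1`. -/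
theorem one_sub_prod_inv_le {ι : Type*} [Fintype ι] (M : ι → ℝ≥0∞) (hM : ∀ i, 1 ≤ M i)
    (hM' : ∀ i, M i ≠ ∞) : 1 - ∏ i, (M i)⁻¹ ≤ ∑ i, (M i - 1) := by
  have h1 := one_le_prod_add_sum Finset.univ (fun i => (M i)⁻¹)
    fun i => ENNReal.inv_le_one.2 (hM i)
  rw [tsub_le_iff_left]
  refine h1.trans (add_le_add_right (Finset.sum_le_sum fun i _ => ?_) _)
  rw [tsub_le_iff_right]
  calc (1 : ℝ≥0∞) = (M i)⁻¹ * M i :=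
        (ENNReal.inv_mul_cancel (zero_lt_one.trans_le (hM i)).ne' (hM' i)).symm
    _ = (M i)⁻¹ * (M i - 1 + 1) := by rw [tsub_add_cancel_of_le (hM i)]
    _ = (M i)⁻¹ * (M i - 1) + (M i)⁻¹ := by rw [mul_add, mul_one]
    _ ≤ 1 * (M i - 1) + (M i)⁻¹ := by gcongr; exact ENNReal.inv_le_one.2 (hM i)
    _ = M i - 1 + (M i)⁻¹ := by rw [one_mul]

/-! ### The law of the corrupted messages. -/

section Attack

variable {d : ℕ} {S Y : Type*} [MeasurableSpace S] [MeasurableSpace Y]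
  [MeasurableSpace.CountableOrCountablyGenerated S Y]
  {hd : 2 ≤ d} {ε : ℝ} {κ : Kernel (Fin d × S) Y} {σ : Fin (d / 2) → Bool} {δ : ℝ}

/-- The mass of the positive part of the amplified deviation. -/
noncomputable def attackMass (hd : 2 ≤ d) (ε : ℝ) (κ : Kernel (Fin d × S) Y)
    (σ : Fin (d / 2) → Bool) (δ : ℝ) (s : S) : ℝ≥0∞ :=
  ∫⁻ y, ENNReal.ofReal (1 + dev hd ε κ σ s y / δ) ∂(baseKernel hd κ s)

theorem abs_dev_le (hε : 0 ≤ ε) (s : S) (y : Y) : |dev hd ε κ σ s y| ≤ Real.exp ε := by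
  calc |dev hd ε κ σ s y| ≤ ∑ j, |pairWeight d j * (pairSign σ j * dens hd ε κ j s y)| :=
        Finset.abs_sum_le_sum_abs _ _
    _ ≤ ∑ j, pairWeight d j * Real.exp ε := Finset.sum_le_sum fun j _ => by
        rw [abs_mul, abs_of_nonneg (pairWeight_nonneg j), abs_mul,
          abs_of_nonneg (dens_nonneg j s y)]
        refine mul_le_mul_of_nonneg_left ?_ (pairWeight_nonneg j)
        exact (mul_le_of_le_one_left (dens_nonneg j s y) (abs_pairSign_le σ j)).trans
          (dens_le_exp hε j s y)
    _ = Real.exp ε := by rw [← Finset.sum_mul, sum_pairWeight hd, one_mul]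

theorem measurable_amplified (hd : 2 ≤ d) (ε : ℝ) (κ : Kernel (Fin d × S) Y)
    (σ : Fin (d / 2) → Bool) (δ : ℝ) :
    Measurable fun q : S × Y => ENNReal.ofReal (1 + dev hd ε κ σ q.1 q.2 / δ) :=
  (((measurable_dev hd ε κ σ).div_const δ).const_add 1).ennreal_ofReal

theorem measurable_dev_right (s : S) : Measurable (dev hd ε κ σ s) := by
  unfold dev
  exact Finset.measurable_sum _ fun j _ =>
    (((measurable_dens hd ε κ j).comp measurable_prodMk_left).const_mul _).const_mul _

/-- The exponential penalty for a large negative deviation. -/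
noncomputable def penalty (hd : 2 ≤ d) (ε : ℝ) (κ : Kernel (Fin d × S) Y)
    (σ : Fin (d / 2) → Bool) (δ lam : ℝ) (s : S) (y : Y) : ℝ :=
  Real.exp (lam * (-(dev hd ε κ σ s y / δ) - 1))

/-- Averaged over the sign patterns, the penalty is exponentially small. -/
theorem sum_penalty_le {ε₀ : ℝ} (hεpos : 0 < ε) (hε' : ε ≤ ε₀) {lam : ℝ} (hlam : 0 < lam)
    (s : S) (y : Y) (hδ : δ = ε * Real.exp ε₀ * √(lam / (d / 2 : ℕ))) :
    ∑ σ : Fin (d / 2) → Bool, penalty hd ε κ σ δ lam s y ≤ 2 ^ (d / 2) * Real.exp (-(lam / 2)) := by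
  set η := ε * Real.exp ε₀ with hη
  have hηpos : 0 < η := by positivity
  have hK : (0 : ℝ) < (d / 2 : ℕ) := by
    have : 0 < d / 2 := by omega
    positivity
  have hδ2 : δ ^ 2 = η ^ 2 * (lam / (d / 2 : ℕ)) := by
    rw [hδ, mul_pow, Real.sq_sqrt (by positivity)]
  have hδpos : 0 < δ := by rw [hδ]; positivity
  -- `exp ε - exp (-ε) = exp ε * (1 - exp (-2ε)) ≤ 2 * ε * exp ε₀`.
  have hub : ∀ j, dens hd ε κ j s y ≤ Real.exp (-ε) + 2 * η := by
    intro j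
    refine (dens_le_exp hεpos.le j s y).trans ?_
    have h1 := Real.add_one_le_exp (-(2 * ε))
    have h2 : Real.exp (-ε) = Real.exp ε * Real.exp (-(2 * ε)) := by
      rw [← Real.exp_add]; ring_nf
    have h3 : Real.exp ε ≤ Real.exp ε₀ := Real.exp_le_exp.2 hε'
    have h4 := Real.exp_pos ε
    rw [h2, hη]
    nlinarith
  -- With `θ = lam / δ`, the choice of `δ` makes the moment generating function `exp (lam / 2)`; the
  -- factor `exp (-lam)` of the penalty leaves `exp (-(lam / 2))`.
  have key := sum_exp_pairSign_le (f := fun j => dens hd ε κ j s y) (η := η)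
    (fun j => exp_neg_le_dens j s y) hub (lam / δ)
  have e1 : ∀ σ : Fin (d / 2) → Bool, penalty hd ε κ σ δ lam s y
      = Real.exp (-(lam / δ) * ∑ j, pairWeight d j * (pairSign σ j * dens hd ε κ j s y))
        * Real.exp (-lam) := by
    intro σ
    rw [penalty, dev, ← Real.exp_add]
    congr 1
    ring
  rw [Finset.sum_congr rfl fun σ _ => e1 σ, ← Finset.sum_mul]
  refine (mul_le_mul_of_nonneg_right key (Real.exp_pos _).le).trans ?_
  rw [mul_assoc, ← Real.exp_add]
  refine mul_le_mul_of_nonneg_left (Real.exp_le_exp.2 (le_of_eq ?_)) (by positivity)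
  rw [div_pow, hδ2]
  field_simp
  ring

theorem measurable_attackMass (hd : 2 ≤ d) (ε : ℝ) (κ : Kernel (Fin d × S) Y) [IsMarkovKernel κ]
    (σ : Fin (d / 2) → Bool) (δ : ℝ) : Measurable (attackMass hd ε κ σ δ) :=
  (measurable_amplified hd ε κ σ δ).lintegral_kernel_prod_right'

variable [IsMarkovKernel κ]

theorem integrable_dev (hε : 0 ≤ ε) (s : S) :
    Integrable (dev hd ε κ σ s) (baseKernel hd κ s) :=
  integrable_of_measurable_of_bounded (measurable_dev_right s) (abs_dev_le hε s)

theorem KernelLDP.integral_dev (h : KernelLDP ε κ) (hε : 0 ≤ ε) (s : S) :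
    ∫ y, dev hd ε κ σ s y ∂(baseKernel hd κ s) = 0 := by
  have hi : ∀ j, Integrable (dens hd ε κ j s) (baseKernel hd κ s) := fun j =>
    integrable_of_measurable_of_bounded ((measurable_dens hd ε κ j).comp measurable_prodMk_left)
      fun y => by rw [abs_of_nonneg (dens_nonneg j s y)]; exact dens_le_exp hε j s y
  simp only [dev]
  rw [integral_finsetSum _ fun j _ => ((hi j).const_mul _).const_mul _]
  simp_rw [integral_const_mul, h.integral_dens, mul_one]
  exact sum_pairWeight_mul_pairSign σ

theorem KernelLDP.integral_amplified (h : KernelLDP ε κ) (hε : 0 ≤ ε) (s : S) :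
    ∫ y, (1 + dev hd ε κ σ s y / δ) ∂(baseKernel hd κ s) = 1 := by
  rw [integral_add (integrable_const _) ((integrable_dev hε s).div_const δ), integral_div,
    h.integral_dev hε]
  simp

theorem integrable_amplified (hε : 0 ≤ ε) (s : S) :
    Integrable (fun y => 1 + dev hd ε κ σ s y / δ) (baseKernel hd κ s) :=
  (integrable_const _).add ((integrable_dev hε s).div_const δ)

/-- The deviation integrates to `0`, so `1 + dev / δ` has integral `1` and its positive part has at
least that. -/
theorem KernelLDP.one_le_attackMass (h : KernelLDP ε κ) (hε : 0 ≤ ε) (s : S) :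
    1 ≤ attackMass hd ε κ σ δ s := by
  have hi := integrable_amplified (hd := hd) (κ := κ) (σ := σ) (δ := δ) hε s
  have h1 := ofReal_integral_eq_lintegral_ofReal hi.pos_part (ae_of_all _ fun y => le_max_right _ _)
  have h2 : ∀ y, ENNReal.ofReal (max (1 + dev hd ε κ σ s y / δ) 0)
      = ENNReal.ofReal (1 + dev hd ε κ σ s y / δ) := fun y => by
    rw [ENNReal.ofReal_max, ENNReal.ofReal_zero]
    exact max_eq_left zero_le
  simp_rw [h2] at h1
  rw [attackMass, ← h1, ENNReal.one_le_ofReal]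
  exact (h.integral_amplified hε s).ge.trans
    (integral_mono hi hi.pos_part fun y => le_max_left _ _)

theorem KernelLDP.attackMass_eq_one (h : KernelLDP ε κ) (hε : 0 ≤ ε) (hδ : 0 < δ) (s : S)
    (hy : ∀ y, -δ ≤ dev hd ε κ σ s y) : attackMass hd ε κ σ δ s = 1 := by
  have hi := integrable_amplified (hd := hd) (κ := κ) (σ := σ) (δ := δ) hε s
  rw [attackMass, ← ofReal_integral_eq_lintegral_ofReal hi, h.integral_amplified hε,
    ENNReal.ofReal_one]
  refine ae_of_all _ fun y => ?_
  have := (div_le_div_iff_of_pos_right hδ).2 (hy y)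
  rw [neg_div, div_self hδ.ne'] at this
  change 0 ≤ 1 + dev hd ε κ σ s y / δ
  linarith

/-- The excess mass is the integral of the negative part of `1 + x`, `x = dev / δ`, which for `lam ≥
1` is at most `exp (lam * (-x - 1))`. -/
theorem KernelLDP.attackMass_sub_one_le (h : KernelLDP ε κ) (hε : 0 ≤ ε) (hδ : 0 < δ) {lam : ℝ}
    (hlam : 1 ≤ lam) (s : S) :
    attackMass hd ε κ σ δ s - 1
      ≤ ∫⁻ y, ENNReal.ofReal (penalty hd ε κ σ δ lam s y) ∂(baseKernel hd κ s) := by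
  have hi := integrable_amplified (hd := hd) (κ := κ) (σ := σ) (δ := δ) hε s
  have hpm : Measurable (penalty hd ε κ σ δ lam s) := by
    have := measurable_dev_right (hd := hd) (ε := ε) (κ := κ) (σ := σ) s
    unfold penalty
    fun_prop
  have hp : Integrable (penalty hd ε κ σ δ lam s) (baseKernel hd κ s) := by
    refine integrable_of_measurable_of_bounded (C := Real.exp (lam * (Real.exp ε / δ))) hpm
      fun y => ?_
    rw [penalty, abs_of_pos (Real.exp_pos _), Real.exp_le_exp]
    refine mul_le_mul_of_nonneg_left ?_ (by linarith)
    have := (div_le_div_iff_of_pos_right hδ).2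
      (abs_le.1 (abs_dev_le (hd := hd) (κ := κ) (σ := σ) hε s y)).1
    rw [neg_div] at this
    linarith
  have hle : ∀ y, max (1 + dev hd ε κ σ s y / δ) 0
      ≤ 1 + dev hd ε κ σ s y / δ + penalty hd ε κ σ δ lam s y := by
    intro y
    have h0 : 0 < penalty hd ε κ σ δ lam s y := Real.exp_pos _
    refine max_le (by linarith) ?_
    set x := dev hd ε κ σ s y / δ
    rcases le_total 0 (1 + x) with h1 | h1
    · linarith
    · have := Real.add_one_le_exp (lam * (-x - 1))
      have h2 : penalty hd ε κ σ δ lam s y = Real.exp (lam * (-x - 1)) := rfl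
      nlinarith
  rw [tsub_le_iff_left, attackMass]
  calc ∫⁻ y, ENNReal.ofReal (1 + dev hd ε κ σ s y / δ) ∂(baseKernel hd κ s)
      ≤ ∫⁻ y, ENNReal.ofReal (1 + dev hd ε κ σ s y / δ + penalty hd ε κ σ δ lam s y)
          ∂(baseKernel hd κ s) :=
        lintegral_mono fun y => ENNReal.ofReal_le_ofReal ((le_max_left _ _).trans (hle y))
    _ = ENNReal.ofReal (∫ y, (1 + dev hd ε κ σ s y / δ + penalty hd ε κ σ δ lam s y)
          ∂(baseKernel hd κ s)) :=
        (ofReal_integral_eq_lintegral_ofReal (hi.add hp)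
          (ae_of_all _ fun y => (le_max_right _ _).trans (hle y))).symm
    _ = ENNReal.ofReal (1 + ∫ y, penalty hd ε κ σ δ lam s y ∂(baseKernel hd κ s)) := by
        rw [integral_add hi hp, h.integral_amplified hε]
    _ = 1 + ∫⁻ y, ENNReal.ofReal (penalty hd ε κ σ δ lam s y) ∂(baseKernel hd κ s) := by
        have h0 : ∀ y, 0 ≤ penalty hd ε κ σ δ lam s y := fun y => (Real.exp_pos _).le
        rw [ENNReal.ofReal_add zero_le_one (integral_nonneg h0),
          ENNReal.ofReal_one, ofReal_integral_eq_lintegral_ofReal hp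
          (ae_of_all _ h0)]

theorem attackMass_ne_top (hε : 0 ≤ ε) (s : S) : attackMass hd ε κ σ δ s ≠ ∞ := by
  have hi := integrable_amplified (hd := hd) (κ := κ) (σ := σ) (δ := δ) hε s
  exact hi.lintegral_lt_top.ne

/-- The normalized positive part of the amplified deviation: the law of the messages that corrupted
users send. -/
noncomputable def attackKernel (hd : 2 ≤ d) (ε : ℝ) (κ : Kernel (Fin d × S) Y) [IsMarkovKernel κ]
    (σ : Fin (d / 2) → Bool) (δ : ℝ) : Kernel S Y :=
  (baseKernel hd κ).withDensity fun s y =>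
    (attackMass hd ε κ σ δ s)⁻¹ * ENNReal.ofReal (1 + dev hd ε κ σ s y / δ)

theorem attackKernel_apply (s : S) (E : Set Y) : attackKernel hd ε κ σ δ s E
    = ∫⁻ y in E, (attackMass hd ε κ σ δ s)⁻¹ * ENNReal.ofReal (1 + dev hd ε κ σ s y / δ)
      ∂(baseKernel hd κ s) := by
  have h0 : Measurable fun q : S × Y => attackMass hd ε κ σ δ q.1 :=
    (measurable_attackMass hd ε κ σ δ).comp measurable_fst
  have h2 := h0.inv.mul (measurable_amplified hd ε κ σ δ)
  rw [attackKernel, Kernel.withDensity_apply']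
  exact h2

theorem KernelLDP.isMarkovKernel_attackKernel (h : KernelLDP ε κ) (hε : 0 ≤ ε) :
    IsMarkovKernel (attackKernel hd ε κ σ δ) := by
  refine ⟨fun s => ⟨?_⟩⟩
  have hm : Measurable fun y => ENNReal.ofReal (1 + dev hd ε κ σ s y / δ) :=
    (((measurable_dev_right s).div_const δ).const_add 1).ennreal_ofReal
  rw [attackKernel_apply, Measure.restrict_univ, lintegral_const_mul _ hm]
  exact ENNReal.inv_mul_cancel (zero_lt_one.trans_le (h.one_le_attackMass hε s)).ne'
    (attackMass_ne_top hε s)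

/-- The heart of the attack. In terms of densities, `1 + t * dev = (1 - t * δ) + t * δ * (1 + dev /
δ)`; passing to positive parts only enlarges the right side, and the factor `M⁻¹` on the left pays
for normalizing the corrupted messages. -/
theorem KernelLDP.smul_tilted_le (h : KernelLDP ε κ) (hε : 0 ≤ ε) (hδ : 0 < δ) {t : ℝ}
    (ht : 0 ≤ t) (ht' : t ≤ 1) (s : S) :
    (attackMass hd ε κ σ δ s)⁻¹ • ∑ j, tiltedPMF hd σ ht ht' j • κ (j, s)
      ≤ (1 - ENNReal.ofReal (t * δ)) • ∑ j, pairUniform hd j • κ (j, s)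
        + ENNReal.ofReal (t * δ) • attackKernel hd ε κ σ δ s := by
  set M := attackMass hd ε κ σ δ s
  have hM : M⁻¹ ≤ 1 := ENNReal.inv_le_one.2 (h.one_le_attackMass hε s)
  have hD := h.withDensity_sum (hd := hd) (fun j => pairWeight d j * (1 + t * pairSign σ j))
    (tilted_nonneg σ ht ht') s
  have hDae : ∀ᵐ y ∂(baseKernel hd κ s),
      ∑ j, pairWeight d j * (1 + t * pairSign σ j) * dens hd ε κ j s y
        = 1 + t * dev hd ε κ σ s y := by
    filter_upwards [h.sum_pairWeight_mul_dens (hd := hd) s] with y hy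
    refine Eq.trans ?_ (congrArg (· + t * dev hd ε κ σ s y) hy)
    simp only [dev]
    rw [Finset.mul_sum, ← Finset.sum_add_distrib]
    exact Finset.sum_congr rfl fun j _ => by ring
  have hAm : Measurable fun y => M⁻¹ * ENNReal.ofReal (1 + dev hd ε κ σ s y / δ) :=
    (((measurable_dev_right s).div_const δ).const_add 1).ennreal_ofReal.const_mul _
  refine Measure.le_intro fun E hE _ => ?_
  have e1 : (∑ j, tiltedPMF hd σ ht ht' j • κ (j, s)) E
      = ∫⁻ y in E, ENNReal.ofReal (1 + t * dev hd ε κ σ s y) ∂(baseKernel hd κ s) := by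
    simp only [tiltedPMF_apply]
    rw [← hD, withDensity_apply _ hE]
    refine lintegral_congr_ae (ae_restrict_of_ae ?_)
    filter_upwards [hDae] with y hy
    rw [hy]
  have e2 : (∑ j, pairUniform hd j • κ (j, s)) E = ∫⁻ _ in E, 1 ∂(baseKernel hd κ s) := by
    rw [setLIntegral_one, baseKernel_apply]
  have hgm : Measurable fun y => ENNReal.ofReal (1 + t * dev hd ε κ σ s y) :=
    (((measurable_dev_right s).const_mul t).const_add 1).ennreal_ofReal
  simp only [Measure.smul_apply, Measure.add_apply, smul_eq_mul]
  rw [e1, e2, attackKernel_apply, ← lintegral_const_mul _ hgm,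
    ← lintegral_const_mul _ measurable_const, ← lintegral_const_mul _ hAm,
    ← lintegral_add_right _ (hAm.const_mul _)]
  refine lintegral_mono fun y => ?_
  have e3 : 1 + t * dev hd ε κ σ s y = (1 - t * δ) + t * δ * (1 + dev hd ε κ σ s y / δ) := by
    field_simp
    ring
  calc M⁻¹ * ENNReal.ofReal (1 + t * dev hd ε κ σ s y)
      ≤ M⁻¹ * (ENNReal.ofReal (1 - t * δ)
          + ENNReal.ofReal (t * δ) * ENNReal.ofReal (1 + dev hd ε κ σ s y / δ)) := by
        rw [e3, ← ENNReal.ofReal_mul (by positivity)]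
        gcongr
        exact ENNReal.ofReal_add_le
    _ = M⁻¹ * ENNReal.ofReal (1 - t * δ)
          + ENNReal.ofReal (t * δ) * (M⁻¹ * ENNReal.ofReal (1 + dev hd ε κ σ s y / δ)) := by
        ring
    _ ≤ (1 - ENNReal.ofReal (t * δ)) * 1
          + ENNReal.ofReal (t * δ) * (M⁻¹ * ENNReal.ofReal (1 + dev hd ε κ σ s y / δ)) := by
        refine add_le_add_left ?_ _
        rw [ENNReal.ofReal_sub _ (by positivity), ENNReal.ofReal_one, mul_one]
        exact mul_le_of_le_one_left zero_le hM

end Attack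

/-! ### Choosing the sign pattern. -/

/-- The probabilistic method, for sign patterns: the pattern determines the data distribution, so it
must be fixed before the public string `s` and be good on average over `s`. -/
theorem exists_lintegral_le_of_sum_le {Γ S : Type*} [Fintype Γ] [Nonempty Γ] [MeasurableSpace S]
    {μ : Measure S} [IsProbabilityMeasure μ] {f : Γ → S → ℝ≥0∞} (hf : ∀ γ, Measurable (f γ))
    {c : ℝ≥0∞} (hc : ∀ s, ∑ γ, f γ s ≤ Fintype.card Γ * c) : ∃ γ, ∫⁻ s, f γ s ∂μ ≤ c := by
  by_contra! hcon
  have h1 : ∑ _γ : Γ, c < ∑ γ, ∫⁻ s, f γ s ∂μ :=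
    ENNReal.sum_lt_sum_of_nonempty Finset.univ_nonempty fun γ _ => hcon γ
  rw [← lintegral_finsetSum _ fun γ _ => hf γ, Finset.sum_const, nsmul_eq_mul,
    Finset.card_univ] at h1
  have h2 : ∫⁻ s, ∑ γ, f γ s ∂μ ≤ ∫⁻ _, Fintype.card Γ * c ∂μ := lintegral_mono hc
  rw [lintegral_const, measure_univ, mul_one] at h2
  exact absurd h1 h2.not_gt

/-- The amplification threshold for a union bound over `N` events. -/
noncomputable def threshold (ε₀ ε : ℝ) (d N : ℕ) : ℝ :=
  ε * Real.exp ε₀ * √(2 * Real.log (20 * N) / (d / 2 : ℕ))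

section Pattern

variable {n d : ℕ} {S Y Z : Type*} [MeasurableSpace S] [MeasurableSpace Y] [MeasurableSpace Z]
  [MeasurableSpace.CountableOrCountablyGenerated S Y]
  {hd : 2 ≤ d} {ε ε₀ : ℝ}

theorem log_twenty_mul_pos {N : ℕ} (hN : 1 ≤ N) : 1 ≤ 2 * Real.log (20 * N) := by
  have hN' : (1 : ℝ) ≤ N := by exact_mod_cast hN
  have h1 : Real.log (Real.exp 1) ≤ Real.log (20 * N) :=
    Real.log_le_log (Real.exp_pos _) (by linarith [Real.exp_one_lt_d9])
  rw [Real.log_exp] at h1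
  linarith

theorem threshold_pos (hε : 0 < ε) (hd : 2 ≤ d) {N : ℕ} (hN : 1 ≤ N) :
    0 < threshold ε₀ ε d N := by
  have := log_twenty_mul_pos hN
  have hK : (0 : ℝ) < (d / 2 : ℕ) := by
    have : 0 < d / 2 := by omega
    positivity
  unfold threshold
  positivity

/-- The choice `lam = 2 * log (20 * N)` turns `exp (-(lam / 2))` into `1 / (20 * N)`, leaving a
total of `1 / 20` after a union over `N` terms. -/
theorem sum_ofReal_penalty_le (hε : 0 < ε) (hε' : ε ≤ ε₀) (κ : Kernel (Fin d × S) Y) {N : ℕ}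
    (hN : 1 ≤ N) (s : S) (y : Y) :
    ∑ σ, ENNReal.ofReal
        (penalty hd ε κ σ (threshold ε₀ ε d N) (2 * Real.log (20 * N)) s y)
      ≤ Fintype.card (Fin (d / 2) → Bool) * (1 / 20 / N) := by
  have hlam := log_twenty_mul_pos hN
  have hNpos : (0 : ℝ) < N := by exact_mod_cast hN
  have h0 : ∀ σ, 0 ≤ penalty hd ε κ σ (threshold ε₀ ε d N) (2 * Real.log (20 * N)) s y :=
    fun σ => (Real.exp_pos _).le
  rw [← ENNReal.ofReal_sum_of_nonneg fun σ _ => h0 σ]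
  refine (ENNReal.ofReal_le_ofReal
    (sum_penalty_le (hd := hd) (κ := κ) hε hε' (by linarith) s y rfl)).trans (le_of_eq ?_)
  have e : Real.exp (-(2 * Real.log (20 * N) / 2)) = 1 / 20 / N := by
    rw [mul_div_cancel_left₀ _ (two_ne_zero), Real.exp_neg, Real.exp_log (by positivity)]
    field_simp
  rw [e, ENNReal.ofReal_mul (by positivity), ENNReal.ofReal_div_of_pos hNpos,
    ENNReal.ofReal_div_of_pos (by norm_num)]
  simp

/-- The probability lost when simulating data drawn from the tilted distribution. -/
noncomputable def loss (hd : 2 ≤ d) (ε : ℝ) (Q : LocalProtocol n (Fin d) S Y Z)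
    (σ : Fin (d / 2) → Bool) (δ : ℝ) (s : S) : ℝ≥0∞ :=
  1 - ∏ i, (attackMass hd ε (Q.randomizer i) σ δ s)⁻¹

/-- The penalty bound is uniform in the message, so integrating it over a user's own message law
costs nothing. Only the sum over the `n` users enters the union bound. -/
theorem sum_loss_le_of_users {Q : LocalProtocol n (Fin d) S Y Z} (hQ : Q.IsLDP ε) (hn : 1 ≤ n)
    (hε : 0 < ε) (hε' : ε ≤ ε₀) (s : S) :
    ∑ σ, loss hd ε Q σ (threshold ε₀ ε d n) s
      ≤ Fintype.card (Fin (d / 2) → Bool) * (1 / 20) := by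
  have hδ := threshold_pos (ε₀ := ε₀) hε hd hn
  have hlam := log_twenty_mul_pos hn
  set δ := threshold ε₀ ε d n
  set lam := 2 * Real.log (20 * n)
  have hQ' : ∀ i, KernelLDP ε (Q.randomizer i) := fun i => hQ i
  calc ∑ σ, loss hd ε Q σ δ s
      ≤ ∑ σ : Fin (d / 2) → Bool, ∑ i, ∫⁻ y,
          ENNReal.ofReal (penalty hd ε (Q.randomizer i) σ δ lam s y)
            ∂(baseKernel hd (Q.randomizer i) s) := by
        refine Finset.sum_le_sum fun σ _ => ?_
        refine (one_sub_prod_inv_le _ (fun i => (hQ' i).one_le_attackMass hε.le s)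
          fun i => attackMass_ne_top hε.le s).trans ?_
        exact Finset.sum_le_sum fun i _ => (hQ' i).attackMass_sub_one_le hε.le hδ hlam s
    _ = ∑ i, ∫⁻ y, ∑ σ : Fin (d / 2) → Bool,
          ENNReal.ofReal (penalty hd ε (Q.randomizer i) σ δ lam s y)
            ∂(baseKernel hd (Q.randomizer i) s) := by
        rw [Finset.sum_comm]
        refine Finset.sum_congr rfl fun i _ => (lintegral_finsetSum _ fun σ _ => ?_).symm
        have := measurable_dev_right (hd := hd) (ε := ε) (κ := Q.randomizer i) (σ := σ) s
        unfold penalty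
        fun_prop
    _ ≤ ∑ i : Fin n, ∫⁻ _, Fintype.card (Fin (d / 2) → Bool) * (1 / 20 / n)
            ∂(baseKernel hd (Q.randomizer i) s) :=
        Finset.sum_le_sum fun i _ => lintegral_mono fun y =>
          sum_ofReal_penalty_le hε hε' (Q.randomizer i) hn s y
    _ = Fintype.card (Fin (d / 2) → Bool) * (1 / 20) := by
        simp only [lintegral_const, measure_univ, mul_one, Finset.sum_const, Finset.card_univ,
          Fintype.card_fin, nsmul_eq_mul]
        rw [mul_left_comm, ENNReal.mul_div_cancel (by simp; omega) (by simp)]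

/-- Nothing is lost unless `dev < -δ` at some message of some randomizer, and then the penalty there
is at least `1`. Users with a common randomizer share these events, so the union runs over pairs
(randomizer, message). -/
theorem sum_loss_le_of_complexity {Q : LocalProtocol n (Fin d) S Y (Fin d → ℝ)} (hQ : Q.IsLDP ε)
    [Finite Y] (hN : 1 ≤ Q.complexity) (hε : 0 < ε) (hε' : ε ≤ ε₀) (s : S) :
    ∑ σ, loss hd ε Q σ (threshold ε₀ ε d Q.complexity) s
      ≤ Fintype.card (Fin (d / 2) → Bool) * (1 / 20) := by
  classical
  have := Fintype.ofFinite Y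
  have hδ := threshold_pos (ε₀ := ε₀) hε hd hN
  have hlam := log_twenty_mul_pos hN
  set N := Q.complexity with hNdef
  set δ := threshold ε₀ ε d N
  set lam := 2 * Real.log (20 * N)
  have hQ' : ∀ i, KernelLDP ε (Q.randomizer i) := fun i => hQ i
  set R := Finset.univ.image Q.randomizer with hR
  have hcard : Fintype.card Y * R.card = N := by
    rw [hNdef, LocalProtocol.complexity, Nat.card_eq_fintype_card, ← Set.image_univ,
      ← Finset.coe_univ, ← Finset.coe_image, Set.ncard_coe_finset]
  have hloss : ∀ σ, loss hd ε Q σ δ s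
      ≤ ∑ κ ∈ R, ∑ y, ENNReal.ofReal (penalty hd ε κ σ δ lam s y) := by
    intro σ
    by_cases hall : ∀ i y, -δ ≤ dev hd ε (Q.randomizer i) σ s y
    · rw [loss, Finset.prod_eq_one]
      · simp
      · intro i _
        rw [(hQ' i).attackMass_eq_one hε.le hδ s (hall i), inv_one]
    · push Not at hall
      obtain ⟨i, y, hy⟩ := hall
      have h1 : (1 : ℝ≥0∞) ≤ ENNReal.ofReal (penalty hd ε (Q.randomizer i) σ δ lam s y) := by
        rw [ENNReal.one_le_ofReal, penalty, Real.one_le_exp_iff]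
        refine mul_nonneg (by linarith) ?_
        have := (div_lt_div_iff_of_pos_right hδ).2 hy
        rw [neg_div, div_self hδ.ne'] at this
        linarith
      calc loss hd ε Q σ δ s ≤ 1 := tsub_le_self
        _ ≤ _ := h1
        _ ≤ ∑ y, ENNReal.ofReal (penalty hd ε (Q.randomizer i) σ δ lam s y) :=
          Finset.single_le_sum (f := fun y =>
            ENNReal.ofReal (penalty hd ε (Q.randomizer i) σ δ lam s y))
            (fun _ _ => zero_le) (Finset.mem_univ y)
        _ ≤ _ := Finset.single_le_sum (f := fun κ : Kernel (Fin d × S) Y =>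
            ∑ y, ENNReal.ofReal (penalty hd ε κ σ δ lam s y)) (fun _ _ => zero_le)
            (Finset.mem_image_of_mem _ (Finset.mem_univ i))
  calc ∑ σ, loss hd ε Q σ δ s
      ≤ ∑ σ : Fin (d / 2) → Bool, ∑ κ ∈ R, ∑ y,
          ENNReal.ofReal (penalty hd ε κ σ δ lam s y) := Finset.sum_le_sum fun σ _ => hloss σ
    _ = ∑ κ ∈ R, ∑ y, ∑ σ : Fin (d / 2) → Bool,
          ENNReal.ofReal (penalty hd ε κ σ δ lam s y) := by
        rw [Finset.sum_comm]
        exact Finset.sum_congr rfl fun κ _ => Finset.sum_comm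
    _ ≤ ∑ κ ∈ R, ∑ _y : Y, Fintype.card (Fin (d / 2) → Bool) * (1 / 20 / (N : ℝ≥0∞)) :=
        Finset.sum_le_sum fun κ _ => Finset.sum_le_sum fun y _ =>
          sum_ofReal_penalty_le hε hε' κ hN s y
    _ = (N : ℝ≥0∞) * (Fintype.card (Fin (d / 2) → Bool) * (1 / 20 / N)) := by
        rw [← hcard]
        simp only [Finset.sum_const, Finset.card_univ, nsmul_eq_mul]
        push_cast
        ring
    _ = Fintype.card (Fin (d / 2) → Bool) * (1 / 20) := by
        rw [mul_left_comm, ENNReal.mul_div_cancel (by simp; omega) (by simp)]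

/-- The separation that an attacker corrupting `m` users can hide. -/
noncomputable def hiddenShift (n m : ℕ) (δ : ℝ) : ℝ := min 1 (m / (10 * n * δ))

theorem hiddenShift_nonneg (n m : ℕ) {δ : ℝ} (hδ : 0 < δ) : 0 ≤ hiddenShift n m δ :=
  le_min zero_le_one (by positivity)

theorem hiddenShift_le_one (n m : ℕ) (δ : ℝ) : hiddenShift n m δ ≤ 1 := min_le_left _ _

theorem hiddenShift_mul_le {n m : ℕ} {δ : ℝ} (hn : 1 ≤ n) (hδ : 0 < δ) :
    hiddenShift n m δ * δ ≤ m / (10 * n) := by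
  have hn' : (0 : ℝ) < n := by exact_mod_cast hn
  calc hiddenShift n m δ * δ ≤ m / (10 * n * δ) * δ :=
        mul_le_mul_of_nonneg_right (min_le_right _ _) hδ.le
    _ = m / (10 * n) := by field_simp

/-- For some sign pattern, data drawn from the tilted distribution can be simulated on uniform
data. -/
theorem exists_simulation {Q : LocalProtocol n (Fin d) S Y Z} (hQ : Q.IsLDP ε) (hn : 1 ≤ n)
    (hε : 0 < ε) {δ : ℝ} (hδ : 0 < δ)
    (hloss : ∀ s, ∑ σ, loss hd ε Q σ δ s ≤ Fintype.card (Fin (d / 2) → Bool) * (1 / 20))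
    {m : ℕ} (hm : m ≤ n) (j₀ : Fin d) :
    ∃ (σ : Fin (d / 2) → Bool) (M : Attacker n m S Y), ∀ E : Set Z, MeasurableSet E →
      Q.manipIID (tiltedPMF hd σ (hiddenShift_nonneg n m hδ) (hiddenShift_le_one n m δ))
          (Q.passiveAttacker m j₀) E
        ≤ Q.manipIID (pairUniform hd) M E + 1 / 10 + 1 / 20 := by
  have hQ' : ∀ i, KernelLDP ε (Q.randomizer i) := fun i => hQ i
  have hmeas : ∀ σ, Measurable (loss hd ε Q σ δ) := fun σ =>
    (Finset.measurable_prod _ fun i _ =>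
      (measurable_attackMass hd ε (Q.randomizer i) σ δ).inv).const_sub 1
  obtain ⟨σ, hσ⟩ := exists_lintegral_le_of_sum_le (μ := Q.publicLaw) hmeas hloss
  have := fun i => (hQ' i).isMarkovKernel_attackKernel (hd := hd) (σ := σ) (δ := δ) hε.le
  set t := hiddenShift n m δ
  have ht := hiddenShift_mul_le (m := m) hn hδ
  have hn' : (0 : ℝ) < n := by exact_mod_cast hn
  have hm' : (m : ℝ) ≤ n := by exact_mod_cast hm
  -- Each user is corrupted with probability `t * δ ≤ m / (10 * n)`, which is what Markov's
  -- inequality requires.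
  obtain ⟨M, hM⟩ := LocalProtocol.exists_attacker_simulating (m := m) Q (pairUniform hd)
    (tiltedPMF hd σ (hiddenShift_nonneg n m hδ) (hiddenShift_le_one n m δ)) j₀
    (fun i => attackKernel hd ε (Q.randomizer i) σ δ) (p := ENNReal.ofReal (t * δ))
    (by
      rw [ENNReal.ofReal_le_one]
      refine ht.trans ?_
      rw [div_le_one (by positivity)]
      linarith)
    (by
      calc (10 : ℝ≥0∞) * (n * ENNReal.ofReal (t * δ))
          ≤ 10 * (n * ENNReal.ofReal (m / (10 * n))) := by gcongr
        _ = ENNReal.ofReal (10 * (n * (m / (10 * n)))) := by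
            rw [ENNReal.ofReal_mul (by norm_num), ENNReal.ofReal_mul hn'.le,
              ENNReal.ofReal_natCast]
            simp
        _ = m := by
            rw [← ENNReal.ofReal_natCast]
            congr 1
            field_simp
        _ ≤ m := le_rfl)
    (fun i s => (attackMass hd ε (Q.randomizer i) σ δ s)⁻¹)
    (fun i s => ENNReal.inv_ne_top.2
      (zero_lt_one.trans_le ((hQ' i).one_le_attackMass hε.le s)).ne')
    (fun i s => (hQ' i).smul_tilted_le hε.le hδ (hiddenShift_nonneg n m hδ)
      (hiddenShift_le_one n m δ) s)
    hσ
  exact ⟨σ, M, hM⟩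

end Pattern

/-! ### The two-point argument. -/

theorem one_third_eq_ofReal : (1 : ℝ≥0∞) / 3 = ENNReal.ofReal (1 / 3) := by
  rw [ENNReal.ofReal_div_of_pos (by norm_num)]; simp

section TwoPoint

variable {n d : ℕ} {S Y : Type*} [MeasurableSpace S] [MeasurableSpace Y]

instance {Z : Type*} [MeasurableSpace Z] {m : ℕ} (Q : LocalProtocol n (Fin d) S Y Z)
    (D : PMF (Fin d)) (M : Attacker n m S Y) : IsProbabilityMeasure (Q.manipIID D M) := by
  refine ⟨?_⟩
  rw [Q.manipIID_eq_lintegral D M MeasurableSet.univ]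
  have h : ∀ s, ∑ x : Fin n → Fin d, (∏ i, D (x i)) *
      ∫⁻ y, Q.aggregator (y, s) Set.univ ∂(Q.manipMessages x M s) = 1 := by
    intro s
    simp only [measure_univ, lintegral_const, mul_one]
    have := Finset.prod_univ_sum (fun _ : Fin n => (Finset.univ : Finset (Fin d))) (fun _ j => D j)
    rw [Fintype.piFinset_univ] at this
    rw [← this]
    simp [LocalProtocol.sum_pmf]
  rw [lintegral_congr h, lintegral_one, measure_univ]

/-- Some linear functional of the output is off by `t / 2`. -/
theorem exists_contrast_error {Q : LocalProtocol n (Fin d) S Y (Fin d → ℝ)} {m : ℕ}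
    {U D : PMF (Fin d)} {ψ : Fin d → ℝ} {t : ℝ} (hU : contrast ψ (fun j => (U j).toReal) = 0)
    (hD : contrast ψ (fun j => (D j).toReal) = t) {M M₀ : Attacker n m S Y}
    (h : ∀ E : Set (Fin d → ℝ), MeasurableSet E →
      Q.manipIID D M₀ E ≤ Q.manipIID U M E + 1 / 10 + 1 / 20) :
    ∃ (D' : PMF (Fin d)) (M' : Attacker n m S Y), ENNReal.ofReal (17 / 40) ≤ Q.manipIID D' M'
      {z | t / 2 ≤ |contrast ψ z - contrast ψ (fun j => (D' j).toReal)|} := by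
  -- The functional is `0` at `U` and `t` at `D`, so `E` is an error for `U` and its complement one
  -- for `D`. The constant solves `x + (x + 1 / 10 + 1 / 20) = 1`, giving `x = 17 / 40`.
  set E : Set (Fin d → ℝ) := {z | t / 2 ≤ contrast ψ z}
  have hE : MeasurableSet E := measurableSet_le measurable_const (measurable_contrast ψ)
  have h1 := h E hE
  have h2 : Q.manipIID D M₀ E + Q.manipIID D M₀ Eᶜ = 1 := by
    rw [measure_add_measure_compl hE, measure_univ]
  by_contra! hcon
  have h3 : Q.manipIID U M E < ENNReal.ofReal (17 / 40) := by
    refine lt_of_le_of_lt (measure_mono fun z hz => ?_) (hcon U M)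
    rw [Set.mem_ofPred_eq, hU, sub_zero]
    exact (show t / 2 ≤ contrast ψ z from hz).trans (le_abs_self _)
  have h4 : Q.manipIID D M₀ Eᶜ < ENNReal.ofReal (17 / 40) := by
    refine lt_of_le_of_lt (measure_mono fun z hz => ?_) (hcon D M₀)
    have hz' : contrast ψ z < t / 2 := not_le.1 hz
    rw [Set.mem_ofPred_eq, hD]
    refine le_trans ?_ (neg_le_abs _)
    linarith
  have e1 : Q.manipIID D M₀ E ≤ ENNReal.ofReal (23 / 40) := by
    refine h1.trans ?_
    have : (1 : ℝ≥0∞) / 10 + 1 / 20 = ENNReal.ofReal (6 / 40) := by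
      rw [show (1 : ℝ≥0∞) / 10 = ENNReal.ofReal (1 / 10) by
          rw [ENNReal.ofReal_div_of_pos (by norm_num)]; simp,
        show (1 : ℝ≥0∞) / 20 = ENNReal.ofReal (1 / 20) by
          rw [ENNReal.ofReal_div_of_pos (by norm_num)]; simp,
        ← ENNReal.ofReal_add (by norm_num) (by norm_num)]
      norm_num
    rw [add_assoc, this]
    refine (add_le_add_left h3.le _).trans ?_
    rw [← ENNReal.ofReal_add (by norm_num) (by norm_num)]
    norm_num
  have e2 : Q.manipIID D M₀ E + Q.manipIID D M₀ Eᶜ < 1 := by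
    calc _ < ENNReal.ofReal (23 / 40) + ENNReal.ofReal (17 / 40) :=
          ENNReal.add_lt_add_of_le_of_lt (measure_ne_top _ _) e1 h4
      _ = 1 := by
        rw [← ENNReal.ofReal_add (by norm_num) (by norm_num)]
        norm_num
  exact e2.ne h2

theorem manipulableOnDistribution_of_contrast {Q : LocalProtocol n (Fin d) S Y (Fin d → ℝ)} {m : ℕ}
    {D : PMF (Fin d)} {M : Attacker n m S Y} {ψ : Fin d → ℝ} (hψ : ∀ j, |ψ j| ≤ 1) {α : ℝ}
    (h : ENNReal.ofReal (17 / 40) ≤ Q.manipIID D M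
      {z | α ≤ |contrast ψ z - contrast ψ (fun j => (D j).toReal)|}) :
    Q.ManipulableOnDistribution m α := by
  refine ⟨D, M, ?_⟩
  calc (1 : ℝ≥0∞) / 3 = ENNReal.ofReal (1 / 3) := one_third_eq_ofReal
    _ ≤ ENNReal.ofReal (17 / 40) := ENNReal.ofReal_le_ofReal (by norm_num)
    _ ≤ _ := h
    _ ≤ _ := measure_mono fun z hz =>
      (show α ≤ |contrast ψ z - _| from hz).trans (abs_contrast_sub_le hψ _ _)

theorem contrast_freq (hn : 1 ≤ n) (ψ : Fin d → ℝ) (x : Fin n → Fin d) :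
    (n : ℝ) * contrast ψ (freq x) = ∑ i, ψ (x i) := by
  have hn' : (n : ℝ) ≠ 0 := by positivity
  rw [contrast, Finset.mul_sum]
  have e : ∀ j, (n : ℝ) * (ψ j * freq x j) = ∑ i, if x i = j then ψ j else 0 := by
    intro j
    rw [freq, ← Finset.sum_filter, Finset.sum_const, nsmul_eq_mul]
    field_simp
  rw [Finset.sum_congr rfl fun j _ => e j, Finset.sum_comm]
  simp

/-- Chebyshev's inequality for a linear functional of the empirical frequencies. -/
theorem pi_contrast_freq_deviation_le (hn : 1 ≤ n) (D : PMF (Fin d)) {ψ : Fin d → ℝ}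
    (hψ : ∀ j, |ψ j| ≤ 1) {u : ℝ} (hu : 0 < u) :
    (Measure.pi fun _ : Fin n => D.toMeasure)
      {x | u ≤ |contrast ψ (freq x) - contrast ψ (fun j => (D j).toReal)|}
        ≤ ENNReal.ofReal (1 / (n * u ^ 2)) := by
  set P := Measure.pi fun _ : Fin n => D.toMeasure
  have hn' : (0 : ℝ) < n := by exact_mod_cast hn
  have hmem : ∀ _i : Fin n, MemLp ψ 2 D.toMeasure := fun _ =>
    MemLp.of_bound (measurable_of_countable _).aestronglyMeasurable 1 (ae_of_all _ hψ)
  have hmean : ∫ j, ψ j ∂D.toMeasure = contrast ψ (fun j => (D j).toReal) := by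
    rw [PMF.integral_eq_sum, contrast]
    exact Finset.sum_congr rfl fun j _ => by rw [smul_eq_mul, mul_comm]
  set X : (Fin n → Fin d) → ℝ := ∑ i, fun x => ψ (x i) with hX
  have hXa : ∀ x, X x = n * contrast ψ (freq x) := fun x => by
    rw [contrast_freq hn, hX, Finset.sum_apply]
  have hXm : MemLp X 2 P :=
    MemLp.of_bound (measurable_of_countable _).aestronglyMeasurable n (ae_of_all _ fun x => by
      rw [hX, Finset.sum_apply]
      refine (norm_sum_le _ _).trans ?_
      calc ∑ i, ‖ψ (x i)‖ ≤ ∑ _i : Fin n, (1 : ℝ) := Finset.sum_le_sum fun i _ => hψ _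
        _ = n := by simp)
  have hvar : Var[X; P] ≤ n := by
    rw [hX, variance_sum_pi (X := fun _ => ψ) hmem]
    calc ∑ _i : Fin n, Var[ψ; D.toMeasure]
        ≤ ∑ _i : Fin n, (1 : ℝ) := Finset.sum_le_sum fun i _ => by
          have := variance_le_sq_of_bounded (μ := D.toMeasure) (X := ψ) (a := -1) (b := 1)
            (ae_of_all _ fun j => abs_le.1 (hψ j)) (measurable_of_countable _).aemeasurable
          norm_num at this
          exact this
      _ = n := by simp
  have hEX : P[X] = n * contrast ψ (fun j => (D j).toReal) := by
    have hint : ∀ i : Fin n, Integrable (fun x : Fin n → Fin d => ψ (x i)) P := fun i =>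
      Integrable.of_bound (measurable_of_countable _).aestronglyMeasurable 1
        (ae_of_all _ fun x => hψ _)
    rw [hX]
    simp only [Finset.sum_apply]
    rw [integral_finsetSum _ fun i _ => hint i]
    have : ∀ i : Fin n, ∫ x : Fin n → Fin d, ψ (x i) ∂P = contrast ψ (fun j => (D j).toReal) := by
      intro i
      rw [← hmean]
      exact integral_comp_eval (μ := fun _ : Fin n => D.toMeasure) (i := i) (f := ψ)
        (measurable_of_countable _).aestronglyMeasurable
    simp [this]
  have hcheb := meas_ge_le_variance_div_sq hXm (c := n * u) (by positivity)
  have hsub : {x | u ≤ |contrast ψ (freq x) - contrast ψ (fun j => (D j).toReal)|}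
      = {x | (n : ℝ) * u ≤ |X x - P[X]|} := by
    ext x
    rw [Set.mem_ofPred_eq, Set.mem_ofPred_eq, hEX, hXa, ← mul_sub, abs_mul, abs_of_pos hn',
      mul_le_mul_iff_right₀ hn']
  rw [hsub]
  refine hcheb.trans (ENNReal.ofReal_le_ofReal ?_)
  rw [div_le_div_iff₀ (by positivity) (by positivity)]
  calc Var[X; P] * (n * u ^ 2) ≤ n * (n * u ^ 2) := by gcongr
    _ = 1 * (n * u) ^ 2 := by ring

/-- Unless the dataset is atypical, which has probability at most `4 / 49`, an error `2 * u` against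
`D` is an error `u` against the frequencies. Failure on all datasets would bound the error
probability by `1 / 3 + 4 / 49 < 17 / 40`. -/
theorem manipulableOnData_of_contrast {Q : LocalProtocol n (Fin d) S Y (Fin d → ℝ)} {m : ℕ}
    (hn : 1 ≤ n) {D : PMF (Fin d)} {M : Attacker n m S Y} {ψ : Fin d → ℝ} (hψ : ∀ j, |ψ j| ≤ 1)
    {u : ℝ} (hu : 0 < u) (hu' : 1 / (n * u ^ 2) ≤ 4 / 49)
    (h : ENNReal.ofReal (17 / 40) ≤ Q.manipIID D M
      {z | 2 * u ≤ |contrast ψ z - contrast ψ (fun j => (D j).toReal)|}) :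
    Q.ManipulableOnData m u := by
  by_contra hcon
  simp only [LocalProtocol.ManipulableOnData, not_exists, not_le] at hcon
  set c₀ := contrast ψ (fun j => (D j).toReal)
  set E := {z | 2 * u ≤ |contrast ψ z - c₀|}
  have hE : MeasurableSet E :=
    measurableSet_le measurable_const (((measurable_contrast ψ).sub_const c₀).abs)
  set B := {x : Fin n → Fin d | u ≤ |contrast ψ (freq x) - c₀|}
  set P := Measure.pi fun _ : Fin n => D.toMeasure
  have key : Q.manipIID D M E ≤ ENNReal.ofReal (1 / 3) + ENNReal.ofReal (4 / 49) := by
    rw [LocalProtocol.manipIID, Measure.bind_apply hE (measurable_of_countable _).aemeasurable]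
    have hB : MeasurableSet B := Set.Finite.measurableSet (Set.toFinite _)
    calc ∫⁻ x, Q.manip x M E ∂P
        ≤ ∫⁻ x, (ENNReal.ofReal (1 / 3) + B.indicator 1 x) ∂P := by
          refine lintegral_mono fun x => ?_
          by_cases hx : x ∈ B
          · rw [Set.indicator_of_mem hx]
            exact prob_le_one.trans le_add_self
          · rw [Set.indicator_of_notMem hx, add_zero]
            have h1 := (hcon x M).le
            rw [one_third_eq_ofReal] at h1
            refine (measure_mono fun z hz => ?_).trans h1
            have hz' : 2 * u ≤ |contrast ψ z - c₀| := hz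
            have hx' : |contrast ψ (freq x) - c₀| < u := not_le.1 hx
            have h2 := abs_contrast_sub_le hψ z (freq x)
            have h3 := abs_sub_le (contrast ψ z) (contrast ψ (freq x)) c₀
            change u ≤ l1Dist z (freq x)
            linarith
      _ = ENNReal.ofReal (1 / 3) + P B := by
          rw [lintegral_add_left measurable_const, lintegral_const, measure_univ, mul_one,
            lintegral_indicator_one hB]
      _ ≤ _ := by
          gcongr
          exact (pi_contrast_freq_deviation_le hn D hψ hu).trans (ENNReal.ofReal_le_ofReal hu')
  have h5 := h.trans key
  rw [← ENNReal.ofReal_add (by norm_num) (by norm_num),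
    ENNReal.ofReal_le_ofReal_iff (by norm_num)] at h5
  norm_num at h5

end TwoPoint

/-! ### Anticoncentration of a lazy random walk. -/

section LazyWalk

/-- The weights of a lazy step: `±1` with probability `q` each, encoded by `(±, true)`, and `0`
otherwise, encoded by `(false, false)`. -/
def lazyWeight (q : ℝ) (a : Bool × Bool) : ℝ := if a.2 then q else if a.1 then 0 else 1 - 2 * q

/-- The value of a lazy step. -/
def lazyStep (a : Bool × Bool) : ℝ := if a.2 then boolSign a.1 else 0

variable {n : ℕ} {q : ℝ}

theorem lazyWeight_nonneg (hq : 0 ≤ q) (hq' : q ≤ 1 / 4) (a : Bool × Bool) :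
    0 ≤ lazyWeight q a := by
  unfold lazyWeight
  split_ifs <;> linarith

/-- The characteristic function of one step is `1 - 2 * q * (1 - cos θ)`, and independence gives its
`n`-th power. -/
theorem sum_lazyWeight_mul_cos (q : ℝ) (n : ℕ) (θ : ℝ) :
    ∑ u : Fin n → Bool × Bool, (∏ i, lazyWeight q (u i)) * Real.cos (θ * ∑ i, lazyStep (u i))
      = (1 - 2 * q * (1 - Real.cos θ)) ^ n := by
  have h1 : ∑ a : Bool × Bool, (lazyWeight q a : ℂ) * Complex.exp ((θ * lazyStep a : ℝ) * Complex.I)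
      = ((1 - 2 * q * (1 - Real.cos θ) : ℝ) : ℂ) := by
    rw [Fintype.sum_prod_type]
    simp only [Fintype.sum_bool, lazyWeight, lazyStep, boolSign, if_true, Bool.false_eq_true,
      if_false, mul_one, mul_neg, mul_zero, Complex.ofReal_zero, zero_mul,
      Complex.exp_zero, add_zero]
    push_cast
    rw [Complex.cos]
    ring_nf
  have h2 := Finset.prod_univ_sum (fun _ : Fin n => (Finset.univ : Finset (Bool × Bool)))
    (fun _ a => (lazyWeight q a : ℂ) * Complex.exp ((θ * lazyStep a : ℝ) * Complex.I))
  rw [Fintype.piFinset_univ, Finset.prod_congr rfl fun i _ => h1, Finset.prod_const,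
    Finset.card_univ, Fintype.card_fin, ← Complex.ofReal_pow] at h2
  have h3 := congrArg Complex.re h2
  rw [Complex.ofReal_re, Complex.re_sum] at h3
  rw [h3]
  refine Finset.sum_congr rfl fun u _ => ?_
  rw [Finset.prod_mul_distrib, ← Complex.exp_sum, ← Finset.sum_mul, ← Complex.ofReal_sum,
    ← Complex.ofReal_prod, Complex.re_ofReal_mul, Complex.exp_ofReal_mul_I_re, Finset.mul_sum]

theorem sum_prod_lazyWeight (q : ℝ) (n : ℕ) :
    ∑ u : Fin n → Bool × Bool, ∏ i, lazyWeight q (u i) = 1 := by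
  simpa using sum_lazyWeight_mul_cos q n 0

/-- The double sum is the Fejér-type kernel `|∑ exp (i k x)| ^ 2`: nonnegative, and close to `L ^ 2`
near `0`. -/
theorem sum_sum_cos_sub (L : ℕ) (x : ℝ) :
    ∑ k ∈ Finset.range L, ∑ l ∈ Finset.range L, Real.cos (((k : ℝ) - l) * x)
      = (∑ k ∈ Finset.range L, Real.cos (k * x)) ^ 2
        + (∑ k ∈ Finset.range L, Real.sin (k * x)) ^ 2 := by
  rw [sq, sq, Finset.sum_mul_sum, Finset.sum_mul_sum, ← Finset.sum_add_distrib]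
  refine Finset.sum_congr rfl fun k _ => ?_
  rw [← Finset.sum_add_distrib]
  exact Finset.sum_congr rfl fun l _ => by rw [sub_mul, Real.cos_sub]

/-- The angle at which the characteristic function of the lazy walk is small. -/
noncomputable def walkAngle (q : ℝ) (n : ℕ) : ℝ := √(8 / q) / √n

/-- The angle `θ` satisfies `θ ^ 2 * n * q = 8`, and `1 - cos φ ≥ φ ^ 2 / 5` for `|φ| ≤ π`, so the
power is at most `exp (-16 / 5)`. The bound `n ≥ 32 / q` gives `θ ≤ 1 / 2`, which keeps `5 * θ`
below `π`. -/
theorem lazyWalk_char_le (hq : 0 < q) (hq' : q ≤ 1 / 4) (hn : 32 / q ≤ n) {k l : ℕ}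
    (hk : k < 6) (hl : l < 6) (hkl : k ≠ l) :
    (1 - 2 * q * (1 - Real.cos (((k : ℝ) - l) * walkAngle q n))) ^ n ≤ 1 / 20 := by
  have hn0 : (0 : ℝ) < n := lt_of_lt_of_le (by positivity) hn
  set θ := walkAngle q n
  have hθ2 : θ ^ 2 * (n * q) = 8 := by
    simp only [θ, walkAngle]
    rw [div_pow, Real.sq_sqrt (by positivity), Real.sq_sqrt hn0.le]
    field_simp
  have hθ0 : 0 ≤ θ := by simp only [θ, walkAngle]; positivity
  have hθ : θ ≤ 1 / 2 := by
    rw [div_le_iff₀ hq] at hn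
    by_contra! hcon
    nlinarith
  set j : ℝ := (k : ℝ) - l
  have hj : |j| ≤ 5 := by
    have h1 : (k : ℝ) ≤ 5 := by exact_mod_cast Nat.le_of_lt_succ hk
    have h2 : (l : ℝ) ≤ 5 := by exact_mod_cast Nat.le_of_lt_succ hl
    rw [abs_le]
    constructor <;> linarith [k.cast_nonneg (α := ℝ), l.cast_nonneg (α := ℝ)]
  have hj1 : 1 ≤ j ^ 2 := by
    have h1 : (1 : ℤ) ≤ |(k : ℤ) - l| := Int.one_le_abs (by omega)
    have h2 : (1 : ℝ) ≤ |j| := by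
      have h3 := (Int.cast_le (R := ℝ)).2 h1
      push_cast at h3
      exact h3
    rw [← sq_abs]
    nlinarith
  have hang : |j * θ| ≤ Real.pi := by
    rw [abs_mul, abs_of_nonneg hθ0]
    nlinarith [Real.pi_gt_three, abs_nonneg j]
  have hcos := Real.cos_le_one_sub_mul_cos_sq hang
  have hpi : Real.pi ^ 2 ≤ 10 := by nlinarith [Real.pi_lt_d2, Real.pi_gt_three]
  have hc1 : θ ^ 2 / 5 ≤ 1 - Real.cos (j * θ) := by
    have h1 : 2 / Real.pi ^ 2 * (j * θ) ^ 2 ≥ 2 / 10 * (1 * θ ^ 2) := by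
      rw [mul_pow]
      gcongr
    linarith
  have hbase : 0 ≤ 1 - 2 * q * (1 - Real.cos (j * θ)) := by
    nlinarith [Real.neg_one_le_cos (j * θ)]
  have hexp : 1 - 2 * q * (1 - Real.cos (j * θ)) ≤ Real.exp (-(2 * q * (θ ^ 2 / 5))) := by
    have := Real.add_one_le_exp (-(2 * q * (θ ^ 2 / 5)))
    nlinarith
  calc (1 - 2 * q * (1 - Real.cos (j * θ))) ^ n ≤ Real.exp (-(2 * q * (θ ^ 2 / 5))) ^ n :=
        pow_le_pow_left₀ hbase hexp n
    _ = Real.exp (-(16 / 5)) := by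
        rw [← Real.exp_nat_mul]
        congr 1
        linear_combination (-2 / 5) * hθ2
    _ ≤ Real.exp (-3) := Real.exp_le_exp.2 (by norm_num)
    _ ≤ 1 / 20 := by
        rw [Real.exp_neg, one_div]
        refine inv_anti₀ (by norm_num) ?_
        have h1 := Real.exp_one_gt_d9
        have h2 : Real.exp 3 = Real.exp 1 ^ 3 := by rw [← Real.exp_nat_mul]; norm_num
        rw [h2]
        calc (20 : ℝ) ≤ 2.7182818283 ^ 3 := by norm_num
          _ ≤ Real.exp 1 ^ 3 := by gcongr

/-- Anticoncentration of the lazy walk. -/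
theorem lazyWalk_anticoncentration (hq : 0 < q) (hq' : q ≤ 1 / 4) (hn : 32 / q ≤ n) :
    2 / 3 ≤ ∑ u : Fin n → Bool × Bool, (∏ i, lazyWeight q (u i)) *
      (if √n / (15 * √(8 / q)) ≤ |∑ i, lazyStep (u i)| then 1 else 0) := by
  have hn0 : (0 : ℝ) < n := lt_of_lt_of_le (by positivity) hn
  set θ := walkAngle q n with hθdef
  have hθ0 : 0 < θ := by simp only [θ, walkAngle]; positivity
  have hr : √n / (15 * √(8 / q)) = 1 / (15 * θ) := by
    rw [hθdef, walkAngle]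
    have : √(n : ℝ) ≠ 0 := by positivity
    have : √(8 / q) ≠ 0 := by positivity
    field_simp
  rw [hr]
  set W : (Fin n → Bool × Bool) → ℝ := fun u => ∏ i, lazyWeight q (u i)
  set T : (Fin n → Bool × Bool) → ℝ := fun u => ∑ i, lazyStep (u i)
  have hW : ∀ u, 0 ≤ W u := fun u => Finset.prod_nonneg fun i _ => lazyWeight_nonneg hq.le hq' _
  set F : ℝ → ℝ := fun x => ∑ k ∈ Finset.range 6, ∑ l ∈ Finset.range 6,
    Real.cos (((k : ℝ) - l) * x)
  have hF0 : ∀ x, 0 ≤ F x := fun x => by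
    simp only [F]
    rw [sum_sum_cos_sub]
    positivity
  have hF1 : ∀ x, |x| ≤ 1 / 15 → 30 ≤ F x := by
    intro x hx
    have hc : ∀ k ∈ Finset.range 6, (23 / 25 : ℝ) ≤ Real.cos (k * x) := by
      intro k hk
      have hk6 : (k : ℝ) ≤ 5 := by exact_mod_cast Nat.le_of_lt_succ (Finset.mem_range.1 hk)
      have h1 := Real.one_sub_sq_div_two_le_cos (x := k * x)
      have h2 : |(k : ℝ) * x| ≤ 2 / 5 := by
        rw [abs_mul, Nat.abs_cast]
        nlinarith [abs_nonneg x]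
      have h3 : ((k : ℝ) * x) ^ 2 ≤ (2 / 5) ^ 2 := by
        rw [← sq_abs]
        gcongr
      linarith
    have h1 := Finset.card_nsmul_le_sum _ _ _ hc
    rw [Finset.card_range, nsmul_eq_mul] at h1
    have h2 : (138 / 25 : ℝ) ≤ ∑ k ∈ Finset.range 6, Real.cos (k * x) := by
      norm_num at h1 ⊢
      linarith
    simp only [F]
    rw [sum_sum_cos_sub]
    nlinarith [sq_nonneg (∑ k ∈ Finset.range 6, Real.sin (k * x))]
  -- The six diagonal terms are `1` and the thirty others at most `1 / 20`. As `F ≥ 30` where `|θ *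
  -- T u| ≤ 1 / 15`, Markov's inequality gives that event probability at most `39 / 150 < 1 / 3`.
  have hEF : ∑ u, W u * F (θ * T u) ≤ 39 / 5 := by
    have e : ∑ u, W u * F (θ * T u) = ∑ k ∈ Finset.range 6, ∑ l ∈ Finset.range 6,
        (1 - 2 * q * (1 - Real.cos (((k : ℝ) - l) * θ))) ^ n := by
      simp only [F, Finset.mul_sum]
      rw [Finset.sum_comm]
      refine Finset.sum_congr rfl fun k _ => ?_
      rw [Finset.sum_comm]
      refine Finset.sum_congr rfl fun l _ => ?_
      rw [← sum_lazyWeight_mul_cos]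
      refine Finset.sum_congr rfl fun u _ => ?_
      rw [mul_assoc]
    rw [e]
    calc _ ≤ ∑ k ∈ Finset.range 6, ∑ l ∈ Finset.range 6, (if k = l then (1 : ℝ) else 1 / 20) := by
          refine Finset.sum_le_sum fun k hk => Finset.sum_le_sum fun l hl => ?_
          split_ifs with h
          · simp [h]
          · exact lazyWalk_char_le hq hq' hn (Finset.mem_range.1 hk) (Finset.mem_range.1 hl) h
      _ ≤ 39 / 5 := by
          simp only [Finset.sum_range_succ, Finset.sum_range_zero]
          norm_num
  have hsmall : ∀ u, W u - W u * F (θ * T u) / 30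
      ≤ W u * (if 1 / (15 * θ) ≤ |T u| then 1 else 0) := by
    intro u
    have h0 := mul_nonneg (hW u) (hF0 (θ * T u))
    split_ifs with h
    · linarith
    · rw [not_le, lt_div_iff₀ (by positivity)] at h
      have h1 := hF1 (θ * T u) (by
        rw [abs_mul, abs_of_pos hθ0]
        linarith)
      have := mul_le_mul_of_nonneg_left h1 (hW u)
      linarith
  refine le_trans ?_ (Finset.sum_le_sum fun u _ => hsmall u)
  rw [Finset.sum_sub_distrib, ← Finset.sum_div]
  have h1 : ∑ u, W u = 1 := sum_prod_lazyWeight q n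
  rw [h1]
  linarith

end LazyWalk

/-! ### Error of order `1 / √n` without corruption, and `1 / n` with one corrupted user. -/

section Resampling

variable {n d : ℕ} {S Y : Type*} [MeasurableSpace S] [MeasurableSpace Y]

/-- Swap the first component of the active pairs. -/
def flipActive (u : Fin n → Bool × Bool) : Fin n → Bool × Bool :=
  fun i => (if (u i).2 then !(u i).1 else (u i).1, (u i).2)

theorem flipActive_involutive : Function.Involutive (flipActive (n := n)) := by
  intro u
  funext i
  rcases h : u i with ⟨a, b⟩
  cases b <;> simp [flipActive, h]

/-- If the message law for the datum `1` is dominated by that for `0`, independent random bits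
cannot be determined from the messages: they may be resampled without changing the messages. -/
theorem resampling_lower_bound {p q : ℝ} (hp : 0 < p) (hp' : p ≤ 1 / 3) (hq : q = p / (1 + p))
    (μ₀ μ₁ : Fin n → Measure Y) [∀ i, IsProbabilityMeasure (μ₀ i)]
    [∀ i, IsProbabilityMeasure (μ₁ i)] (hle : ∀ i, ENNReal.ofReal p • μ₁ i ≤ μ₀ i)
    {G : (Fin n → Bool) → (Fin n → Y) → ℝ≥0∞} (hG : ∀ b, Measurable (G b))
    (gap : (Fin n → Bool × Bool) → Prop) [DecidablePred gap]
    (hgap : ∀ u, gap u → ∀ y,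
      1 ≤ G (fun i => (u i).1) y + G (fun i => (flipActive u i).1) y) :
    ENNReal.ofReal (∑ u : Fin n → Bool × Bool, (∏ i, lazyWeight q (u i)) * if gap u then 1 else 0)
      ≤ 2 * ∑ b : Fin n → Bool, (∏ i, ENNReal.ofReal (if b i then q else 1 - q))
        * ∫⁻ y, G b y ∂(Measure.pi fun i => if b i then μ₁ i else μ₀ i) := by
  have h1p : 0 < 1 + p := by linarith
  have hq0 : 0 < q := by rw [hq]; positivity
  have hq4 : q ≤ 1 / 4 := by rw [hq, div_le_iff₀ h1p]; linarith
  have hqp : (1 - q) * p = q := by rw [hq]; field_simp; ring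
  have hqp' : (1 - q) * (1 - p) = 1 - 2 * q := by linear_combination -hqp
  -- A hidden label `v` says whether the message came from the `μ₁` part of the law. Since `(1 - q)
  -- * p = q`, a bit with label `true` is fair given the message, so flipping all such bits
  -- preserves the joint law.
  let ρ : Fin n → Bool → Measure Y := fun i v =>
    if v then μ₁ i else μ₀ i - ENNReal.ofReal p • μ₁ i
  have hfin : ∀ i, IsFiniteMeasure (ENNReal.ofReal p • μ₁ i) := fun i =>
    Measure.smul_finite _ ENNReal.ofReal_ne_top
  have hρ : ∀ i v, IsFiniteMeasure (ρ i v) := by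
    intro i v
    cases v <;> simp [ρ] <;> infer_instance
  let c : Bool → Bool → ℝ := fun b v => if v then (if b then 1 else p) else (if b then 0 else 1)
  let w : Bool → ℝ := fun b => if b then q else 1 - q
  have hw : ∀ b, 0 ≤ w b := by intro b; cases b <;> (simp [w]; linarith)
  have hc : ∀ b v, 0 ≤ c b v := by intro b v; cases b <;> cases v <;> simp [c] <;> linarith
  have hmix : ∀ (b : Bool) i, (if b then μ₁ i else μ₀ i)
      = ∑ v, ENNReal.ofReal (c b v) • ρ i v := by
    intro b i
    cases b
    · simp only [Bool.false_eq_true, if_false, Fintype.sum_bool, c, ρ, if_true,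
        ENNReal.ofReal_one, one_smul]
      rw [add_comm]
      exact (Measure.sub_add_cancel_of_le (hle i)).symm
    · simp [c, ρ]
  have hmass : ∀ i a, ENNReal.ofReal (w a.1 * c a.1 a.2) * ρ i a.2 Set.univ
      = ENNReal.ofReal (lazyWeight q a) := by
    rintro i ⟨b, v⟩
    cases v
    · have hm : ρ i false Set.univ = ENNReal.ofReal (1 - p) := by
        simp only [ρ, Bool.false_eq_true, if_false]
        rw [Measure.sub_apply MeasurableSet.univ (hle i), Measure.smul_apply, measure_univ,
          measure_univ, ENNReal.ofReal_sub _ hp.le]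
        simp
      cases b
      · rw [hm, ← ENNReal.ofReal_mul (mul_nonneg (hw _) (hc _ _))]
        simp [w, c, lazyWeight, hqp']
      · simp [c, lazyWeight]
    · cases b <;> simp [w, c, ρ, lazyWeight, hqp]
  set B : (Fin n → Bool × Bool) → ℝ≥0∞ := fun u =>
    (∏ i, ENNReal.ofReal (w (u i).1 * c (u i).1 (u i).2)) * ∫⁻ y, G (fun i => (u i).1) y ∂(Measure.pi fun i => ρ i (u i).2) with hB
  have hexpand : ∑ b : Fin n → Bool, (∏ i, ENNReal.ofReal (if b i then q else 1 - q))
        * ∫⁻ y, G b y ∂(Measure.pi fun i => if b i then μ₁ i else μ₀ i) = ∑ u, B u := by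
    rw [← (Equiv.arrowProdEquivProdArrow (Fin n) (fun _ => Bool) fun _ => Bool).symm.sum_comp,
      Fintype.sum_prod_type]
    refine Finset.sum_congr rfl fun b _ => ?_
    have e : (fun i => if b i then μ₁ i else μ₀ i)
        = fun i => ∑ v, ENNReal.ofReal (c (b i) v) • ρ i v := funext fun i => hmix (b i) i
    rw [e, lintegral_pi_sum_smul _ (fun _ _ => ENNReal.ofReal_ne_top), Finset.mul_sum]
    refine Finset.sum_congr rfl fun v _ => ?_
    rw [← mul_assoc, ← Finset.prod_mul_distrib, hB]
    congr 1
    refine Finset.prod_congr rfl fun i _ => ?_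
    exact (ENNReal.ofReal_mul (hw (b i))).symm
  have hflip : ∑ u, B (flipActive u) = ∑ u, B u :=
    Equiv.sum_comp flipActive_involutive.toPerm B
  have hJ : ∀ a : Bool × Bool, w (if a.2 then !a.1 else a.1) * c (if a.2 then !a.1 else a.1) a.2
      = w a.1 * c a.1 a.2 := by
    rintro ⟨b, v⟩
    cases b <;> cases v <;> simp [w, c, hqp]
  rw [hexpand, two_mul]
  nth_rewrite 2 [← hflip]
  rw [← Finset.sum_add_distrib, ENNReal.ofReal_sum_of_nonneg fun u _ => mul_nonneg
    (Finset.prod_nonneg fun i _ => lazyWeight_nonneg hq0.le hq4 _) (by split_ifs <;> norm_num)]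
  refine Finset.sum_le_sum fun u _ => ?_
  have hBf : B (flipActive u) = (∏ i, ENNReal.ofReal (w (u i).1 * c (u i).1 (u i).2))
      * ∫⁻ y, G (fun i => (flipActive u i).1) y ∂(Measure.pi fun i => ρ i (u i).2) := by
    simp only [hB]
    congr 1
    exact Finset.prod_congr rfl fun i _ => by rw [flipActive, hJ]
  rw [hBf]
  simp only [hB]
  rw [← mul_add, ← lintegral_add_left (hG _)]
  split_ifs with hu
  · rw [mul_one, ENNReal.ofReal_prod_of_nonneg fun i _ => lazyWeight_nonneg hq0.le hq4 _]
    calc ∏ i, ENNReal.ofReal (lazyWeight q (u i))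
        = (∏ i, ENNReal.ofReal (w (u i).1 * c (u i).1 (u i).2))
            * ∫⁻ _, 1 ∂(Measure.pi fun i => ρ i (u i).2) := by
          rw [lintegral_one, Measure.pi_univ, ← Finset.prod_mul_distrib]
          exact Finset.prod_congr rfl fun i _ => (hmass i (u i)).symm
      _ ≤ _ := mul_le_mul_right (lintegral_mono fun y => hgap u hu y) _
  · simp

/-- The functional that separates the datum `j₁` from the others. -/
def indicatorSign (j₁ : Fin d) (j : Fin d) : ℝ := if j = j₁ then 1 else -1

theorem abs_indicatorSign_le (j₁ j : Fin d) : |indicatorSign j₁ j| ≤ 1 := by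
  unfold indicatorSign
  split_ifs <;> simp

/-- By the triangle inequality no output is within `α` of both `f` and `g`; this is used for pairs
of datasets the messages cannot distinguish. -/
theorem one_le_measure_add_of_contrast {μ : Measure (Fin d → ℝ)} [IsProbabilityMeasure μ] {α : ℝ}
    {f g : Fin d → ℝ} {ψ : Fin d → ℝ} (hψ : ∀ j, |ψ j| ≤ 1)
    (h : 2 * α ≤ |contrast ψ f - contrast ψ g|) :
    1 ≤ μ {z | α ≤ l1Dist z f} + μ {z | α ≤ l1Dist z g} := by
  refine le_trans ?_ (measure_union_le _ _)
  rw [← measure_univ (μ := μ)]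
  refine measure_mono fun z _ => ?_
  by_contra hz
  simp only [Set.mem_union, Set.mem_ofPred_eq, not_or, not_le] at hz
  have h1 := abs_contrast_sub_le hψ z f
  have h2 := abs_contrast_sub_le hψ z g
  have h3 := abs_sub_le (contrast ψ f) (contrast ψ z) (contrast ψ g)
  rw [abs_sub_comm (contrast ψ f) (contrast ψ z)] at h3
  linarith

theorem measurable_l1Dist (f : Fin d → ℝ) : Measurable fun z => l1Dist z f := by
  unfold l1Dist
  fun_prop

/-- Without any corruption, the error on some dataset is of order `1 / √n`. -/
theorem manipulableOnData_of_resampling {ε ε₀ : ℝ} {Q : LocalProtocol n (Fin d) S Y (Fin d → ℝ)}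
    (hQ : Q.IsLDP ε) (hε : ε ≤ ε₀) (hε₀ : 0 ≤ ε₀) {j₀ j₁ : Fin d} (hj : j₀ ≠ j₁) {p q : ℝ}
    (hp : p = Real.exp (-ε₀) / 3) (hq : q = p / (1 + p)) (hn : 32 / q ≤ n) (m : ℕ) :
    Q.ManipulableOnData m (1 / (15 * √(8 / q)) / √n) := by
  classical
  have hp0 : 0 < p := by rw [hp]; positivity
  have hp3 : p ≤ 1 / 3 := by
    rw [hp]
    have : Real.exp (-ε₀) ≤ 1 := Real.exp_le_one_iff.2 (by linarith)
    linarith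
  have hq0 : 0 < q := by rw [hq]; positivity
  have hq4 : q ≤ 1 / 4 := by rw [hq, div_le_iff₀ (by linarith)]; linarith
  have hn0 : (0 : ℝ) < n := lt_of_lt_of_le (by positivity) hn
  have hn1 : 1 ≤ n := by exact_mod_cast hn0
  set α := 1 / (15 * √(8 / q)) / √n
  by_contra hcon
  simp only [LocalProtocol.ManipulableOnData, not_exists, not_le] at hcon
  let x : (Fin n → Bool) → Fin n → Fin d := fun b i => if b i then j₁ else j₀
  let E : (Fin n → Bool) → Set (Fin d → ℝ) := fun b => {z | α ≤ l1Dist z (freq (x b))}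
  have hE : ∀ b, MeasurableSet (E b) := fun b =>
    measurableSet_le measurable_const (measurable_l1Dist _)
  set W : (Fin n → Bool) → ℝ≥0∞ := fun b => ∏ i, ENNReal.ofReal (if b i then q else 1 - q)
  have hW0 : ∀ b, W b ≠ 0 := fun b => Finset.prod_ne_zero_iff.2 fun i _ => by
    rw [Ne, ENNReal.ofReal_eq_zero, not_le]
    split_ifs <;> linarith
  have hWt : ∀ b, W b ≠ ∞ := fun b => ENNReal.prod_ne_top fun i _ => ENNReal.ofReal_ne_top
  have hWs : ∑ b, W b = 1 := by
    have := Finset.prod_univ_sum (fun _ : Fin n => (Finset.univ : Finset Bool))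
      (fun _ b => ENNReal.ofReal (if b then q else 1 - q))
    rw [Fintype.piFinset_univ] at this
    rw [← this]
    refine Finset.prod_eq_one fun i _ => ?_
    rw [Fintype.sum_bool, ← ENNReal.ofReal_add (by simp; linarith) (by simp; linarith)]
    simp
  have hψx : ∀ b i, indicatorSign j₁ (x b i) = boolSign (b i) := by
    intro b i
    cases h : b i <;> simp [x, h, indicatorSign, boolSign, hj]
  let gap : (Fin n → Bool × Bool) → Prop := fun u => √n / (15 * √(8 / q)) ≤ |∑ i, lazyStep (u i)|
  have hgap : ∀ u, gap u → 2 * α ≤ |contrast (indicatorSign j₁) (freq (x fun i => (u i).1))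
      - contrast (indicatorSign j₁) (freq (x fun i => (flipActive u i).1))| := by
    -- Flipping changes the functional only at active users, by `±2` each.
    intro u hu
    have e : (n : ℝ) * (contrast (indicatorSign j₁) (freq (x fun i => (u i).1))
        - contrast (indicatorSign j₁) (freq (x fun i => (flipActive u i).1)))
        = 2 * ∑ i, lazyStep (u i) := by
      rw [mul_sub, contrast_freq hn1, contrast_freq hn1, ← Finset.sum_sub_distrib, Finset.mul_sum]
      refine Finset.sum_congr rfl fun i _ => ?_
      refine (congrArg₂ (· - ·) (hψx (fun i => (u i).1) i)
        (hψx (fun i => (flipActive u i).1) i)).trans ?_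
      rcases h : u i with ⟨a, b⟩
      cases a <;> cases b <;> simp [flipActive, lazyStep, boolSign, h] <;> norm_num
    have hα : (n : ℝ) * α = √n / (15 * √(8 / q)) := by
      have h1 : √(n : ℝ) * √n = n := Real.mul_self_sqrt hn0.le
      have h2 : √(n : ℝ) ≠ 0 := by positivity
      have h3 : √(8 / q) ≠ 0 := by positivity
      simp only [α]
      field_simp
      rw [sq, h1]
    rw [← mul_le_mul_iff_right₀ hn0]
    nth_rewrite 2 [← abs_of_pos hn0]
    rw [← abs_mul, e, abs_mul, abs_two, mul_left_comm, hα]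
    exact mul_le_mul_of_nonneg_left hu (by norm_num)
  have hlow : ∀ s, ENNReal.ofReal (1 / 3) ≤ ∑ b, W b * ∫⁻ y, Q.aggregator (y, s) (E b)
      ∂(Measure.pi fun i => Q.randomizer i (x b i, s)) := by
    intro s
    have hle : ∀ i, ENNReal.ofReal p • Q.randomizer i (j₁, s) ≤ Q.randomizer i (j₀, s) := by
      intro i
      refine Measure.le_intro fun A hA _ => ?_
      rw [Measure.smul_apply, smul_eq_mul]
      calc ENNReal.ofReal p * Q.randomizer i (j₁, s) A
          ≤ ENNReal.ofReal p * (ENNReal.ofReal (Real.exp ε) * Q.randomizer i (j₀, s) A) :=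
            mul_le_mul_right (hQ i j₁ j₀ s A hA) _
        _ = ENNReal.ofReal (p * Real.exp ε) * Q.randomizer i (j₀, s) A := by
            rw [← mul_assoc, ENNReal.ofReal_mul hp0.le]
        _ ≤ 1 * Q.randomizer i (j₀, s) A := by
            refine mul_le_mul_left ?_ _
            rw [ENNReal.ofReal_le_one, hp, div_mul_eq_mul_div, ← Real.exp_add]
            have : Real.exp (-ε₀ + ε) ≤ 1 := Real.exp_le_one_iff.2 (by linarith)
            linarith
        _ = Q.randomizer i (j₀, s) A := one_mul _
    have h1 := resampling_lower_bound hp0 hp3 hq (fun i => Q.randomizer i (j₀, s))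
      (fun i => Q.randomizer i (j₁, s)) hle (G := fun b y => Q.aggregator (y, s) (E b))
      (fun b => Q.measurable_aggregator_apply s (hE b)) gap
      (fun u hu y => one_le_measure_add_of_contrast (abs_indicatorSign_le j₁) (hgap u hu))
    have h2 := ENNReal.ofReal_le_ofReal (lazyWalk_anticoncentration hq0 hq4 hn)
    have h3 := h2.trans h1
    have h4 : ENNReal.ofReal (2 / 3) = 2 * ENNReal.ofReal (1 / 3) := by
      rw [show (2 : ℝ) / 3 = 2 * (1 / 3) by norm_num, ENNReal.ofReal_mul (by norm_num)]
      simp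
    rw [h4, ENNReal.mul_le_mul_iff_right (by simp) (by simp)] at h3
    refine h3.trans (le_of_eq (Finset.sum_congr rfl fun b _ => ?_))
    congr 4
    funext i
    cases h : b i <;> simp [x, h]
  have hmain :
      ENNReal.ofReal (1 / 3) ≤ ∑ b, W b * Q.manip (x b) (Q.passiveAttacker m j₀) (E b) := by
    have e : ∑ b, W b * Q.manip (x b) (Q.passiveAttacker m j₀) (E b)
        = ∫⁻ s, ∑ b, W b * ∫⁻ y, Q.aggregator (y, s) (E b)
          ∂(Q.manipMessages (x b) (Q.passiveAttacker m j₀) s) ∂Q.publicLaw := by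
      rw [lintegral_finsetSum _ fun b _ =>
        (Q.measurable_lintegral_manipMessages _ _ (hE b)).const_mul _]
      refine Finset.sum_congr rfl fun b _ => ?_
      rw [lintegral_const_mul _ (Q.measurable_lintegral_manipMessages _ _ (hE b)),
        LocalProtocol.manip_apply _ _ _ (hE b)]
    rw [e]
    calc ENNReal.ofReal (1 / 3) = ∫⁻ _, ENNReal.ofReal (1 / 3) ∂Q.publicLaw := by simp
      _ ≤ _ := lintegral_mono fun s => (hlow s).trans (le_of_eq (Finset.sum_congr rfl fun b _ => by
          rw [LocalProtocol.lintegral_manipMessages_passiveAttacker _ _ _ _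
            (Q.measurable_aggregator_apply s (hE b))]))
  -- All weights are positive and finite, so an error probability below `1 / 3` on every dataset
  -- gives a strict inequality for the average.
  refine absurd hmain (not_le.2 ?_)
  calc ∑ b, W b * Q.manip (x b) (Q.passiveAttacker m j₀) (E b)
      < ∑ b, W b * ENNReal.ofReal (1 / 3) := by
        refine ENNReal.sum_lt_sum_of_nonempty Finset.univ_nonempty fun b _ => ?_
        have := hcon (x b) (Q.passiveAttacker m j₀)
        rw [one_third_eq_ofReal] at this
        exact (ENNReal.mul_lt_mul_iff_right (hW0 b) (hWt b)).2 this
    _ = ENNReal.ofReal (1 / 3) := by rw [← Finset.sum_mul, hWs, one_mul]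

/-- One corrupted user can hide its own datum. -/
theorem manipulableOnData_of_one_user (Q : LocalProtocol n (Fin d) S Y (Fin d → ℝ)) (hn : 1 ≤ n)
    {j₀ j₁ : Fin d} (hj : j₀ ≠ j₁) {m : ℕ} (hm : 1 ≤ m) : Q.ManipulableOnData m (1 / n) := by
  classical
  have hn0 : (0 : ℝ) < n := by exact_mod_cast hn
  let i₀ : Fin n := ⟨0, hn⟩
  have (i : Fin n) : IsMarkovKernel (fiberKernel (Q.randomizer i) j₀) :=
    Kernel.IsMarkovKernel.comap _ measurable_prodMk_left
  let M : Attacker n m S Y := mixtureAttacker (fun _ : Unit => 1) (by simp) (fun _ => {i₀})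
    (by simpa using hm) (fun i => fiberKernel (Q.randomizer i) j₀)
  let x : Fin n → Fin d := fun _ => j₀
  -- The two datasets differ only at the corrupted user, whose message ignores its datum.
  let x' : Fin n → Fin d := Function.update x i₀ j₁
  have hmanip : ∀ E, MeasurableSet E → Q.manip x M E = Q.manip x' M E := by
    intro E hE
    rw [LocalProtocol.manip_apply _ _ _ hE, LocalProtocol.manip_apply _ _ _ hE]
    refine lintegral_congr fun s => ?_
    rw [LocalProtocol.lintegral_manipMessages_mixtureAttacker _ _ _ _ _ _ _ _
        (Q.measurable_aggregator_apply s hE),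
      LocalProtocol.lintegral_manipMessages_mixtureAttacker _ _ _ _ _ _ _ _
        (Q.measurable_aggregator_apply s hE)]
    refine Finset.sum_congr rfl fun c _ => ?_
    congr 3
    funext i
    by_cases hi : i = i₀
    · simp [hi]
    · simp [hi, x', x]
  have hgap : 2 * (1 / (n : ℝ)) ≤ |contrast (indicatorSign j₁) (freq x')
      - contrast (indicatorSign j₁) (freq x)| := by
    have e : (n : ℝ) * (contrast (indicatorSign j₁) (freq x')
        - contrast (indicatorSign j₁) (freq x)) = 2 := by
      rw [mul_sub, contrast_freq hn, contrast_freq hn, ← Finset.sum_sub_distrib,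
        Finset.sum_eq_single i₀]
      · simp [x', x, indicatorSign, hj]
        norm_num
      · intro i _ hi
        simp [x', hi]
      · simp
    have e2 : contrast (indicatorSign j₁) (freq x') - contrast (indicatorSign j₁) (freq x)
        = 2 * (1 / (n : ℝ)) := by
      field_simp
      linarith
    rw [e2]
    exact le_abs_self _
  have h1 := one_le_measure_add_of_contrast (μ := Q.manip x M) (abs_indicatorSign_le j₁) hgap
  by_contra hcon
  simp only [LocalProtocol.ManipulableOnData, not_exists, not_le] at hcon
  have h2 := hcon x M
  have h3 := hcon x' M
  rw [← hmanip _ (measurableSet_le measurable_const (measurable_l1Dist _))] at h3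
  have h4 := h1.trans (add_le_add h3.le h2.le)
  rw [one_third_eq_ofReal, ← ENNReal.ofReal_add (by norm_num) (by norm_num),
    ENNReal.one_le_ofReal] at h4
  norm_num at h4

end Resampling

/-! ### Combining the regimes and comparing the constants. -/

section Assembly

variable {n d : ℕ} {S Y : Type*} [MeasurableSpace S] [MeasurableSpace Y]

theorem LocalProtocol.ManipulableOnData.mono {Q : LocalProtocol n (Fin d) S Y (Fin d → ℝ)} {m : ℕ}
    {α β : ℝ} (h : Q.ManipulableOnData m β) (hαβ : α ≤ β) : Q.ManipulableOnData m α := by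
  obtain ⟨x, M, hx⟩ := h
  exact ⟨x, M, hx.trans (measure_mono fun z hz => hαβ.trans hz)⟩

theorem LocalProtocol.ManipulableOnDistribution.mono
    {Q : LocalProtocol n (Fin d) S Y (Fin d → ℝ)} {m : ℕ} {α β : ℝ}
    (h : Q.ManipulableOnDistribution m β) (hαβ : α ≤ β) : Q.ManipulableOnDistribution m α := by
  obtain ⟨D, M, hx⟩ := h
  exact ⟨D, M, hx.trans (measure_mono fun z hz => hαβ.trans hz)⟩

theorem manipulableOnData_zero (Q : LocalProtocol n (Fin d) S Y (Fin d → ℝ)) (j₀ : Fin d) (m : ℕ) :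
    Q.ManipulableOnData m 0 := by
  refine ⟨fun _ => j₀, Q.passiveAttacker m j₀, ?_⟩
  have : {z : Fin d → ℝ | 0 ≤ l1Dist z (freq fun _ : Fin n => j₀)} = Set.univ :=
    Set.eq_univ_of_forall fun z =>
      show 0 ≤ l1Dist z _ from Finset.sum_nonneg fun j _ => abs_nonneg _
  rw [this, measure_univ, one_third_eq_ofReal, ENNReal.ofReal_le_one]
  norm_num

/-- The probability that a datum is masked in the resampling argument. -/
noncomputable def maskProb (ε₀ : ℝ) : ℝ := Real.exp (-ε₀) / 3 / (1 + Real.exp (-ε₀) / 3)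

theorem maskProb_pos (ε₀ : ℝ) : 0 < maskProb ε₀ := by
  unfold maskProb
  positivity

/-- The constant in the error bound for datasets. -/
noncomputable def dataConst (ε₀ : ℝ) : ℝ :=
  min (1 / 4) (min (maskProb ε₀ / 32) (1 / (15 * √(8 / maskProb ε₀)) / 14))

theorem dataConst_pos (ε₀ : ℝ) : 0 < dataConst ε₀ := by
  have := maskProb_pos ε₀
  unfold dataConst
  positivity

/-- Once `m / n` exceeds the claimed bound the minimum equals `1`, so the guaranteed error is `c`
itself. -/
theorem breakdown_le_of_manipulable {P : ℕ → ℝ → Prop} {ε : ℝ} (hd : 2 ≤ d)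
    (hε : 0 < ε) {ℓ c : ℝ} (hℓ : 0 < ℓ)
    (h : ∀ m : ℕ, m ≤ n → P m (c * min 1 ((m / n : ℝ) * (√d / (ε * √ℓ))))) :
    sSup {β : ℝ | ∃ m : ℕ, m ≤ n ∧ ¬ P m c ∧ β = (m : ℝ) / n} ≤ 1 * (ε * √(ℓ / d)) := by
  have hd0 : (0 : ℝ) < d := by
    have : 0 < d := by omega
    exact_mod_cast this
  refine Real.sSup_le ?_ (by positivity)
  rintro β ⟨m, hm, hP, rfl⟩
  by_contra! hcon
  refine hP ?_
  have h1 : 1 ≤ (m / n : ℝ) * (√d / (ε * √ℓ)) := by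
    rw [one_mul, Real.sqrt_div hℓ.le] at hcon
    have hsd : 0 < √(d : ℝ) := by positivity
    rw [← mul_div_assoc, le_div_iff₀ (by positivity), one_mul]
    rw [← mul_div_assoc, div_lt_iff₀ hsd] at hcon
    exact hcon.le
  have h2 := h m hm
  rwa [min_eq_left h1, mul_one] at h2

theorem log_twenty_mul_le {n : ℕ} (hn : 2 ≤ n) : Real.log (20 * n) ≤ 6 * Real.log n := by
  have hn' : (2 : ℝ) ≤ n := by exact_mod_cast hn
  rw [show (6 : ℝ) * Real.log n = ((6 : ℕ) : ℝ) * Real.log n by norm_num, ← Real.log_pow]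
  refine Real.log_le_log (by positivity) ?_
  calc (20 : ℝ) * n ≤ 2 ^ 5 * n := by gcongr; norm_num
    _ ≤ (n : ℝ) ^ 5 * n := by gcongr
    _ = (n : ℝ) ^ 6 := by ring

theorem log_twenty_mul_le' {N : ℕ} (hN : 1 ≤ N) :
    Real.log (20 * N) ≤ 6 * Real.log (12 * N) := by
  have hN' : (1 : ℝ) ≤ N := by exact_mod_cast hN
  rw [show (6 : ℝ) * Real.log (12 * N) = ((6 : ℕ) : ℝ) * Real.log (12 * N) by norm_num,
    ← Real.log_pow]
  refine Real.log_le_log (by positivity) ?_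
  calc (20 : ℝ) * N ≤ (12 * N) ^ 2 := by nlinarith
    _ ≤ (12 * N : ℝ) ^ 6 := pow_le_pow_right₀ (by linarith) (by norm_num)

theorem one_le_complexity [Finite Y] (hd : 2 ≤ d) (hn : 1 ≤ n)
    (Q : LocalProtocol n (Fin d) S Y (Fin d → ℝ)) : 1 ≤ Q.complexity := by
  let i₀ : Fin n := ⟨0, hn⟩
  let j₀ : Fin d := ⟨0, by omega⟩
  have : Nonempty S := Q.publicLaw.nonempty_of_neZero
  obtain ⟨s⟩ := this
  have : Nonempty Y := (Q.randomizer i₀ (j₀, s)).nonempty_of_neZero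
  refine Nat.one_le_iff_ne_zero.2 (Nat.mul_ne_zero Nat.card_pos.ne' ?_)
  exact ((Set.ncard_pos (Set.finite_range _)).2 ⟨_, ⟨i₀, rfl⟩⟩).ne'

variable [MeasurableSpace.CountableOrCountablyGenerated S Y] {ε ε₀ δ : ℝ}

/-- Both kinds of manipulation, in terms of the separation that the attacker can hide. -/
theorem manipulable_of_loss (hd : 2 ≤ d) (hn : 1 ≤ n)
    {Q : LocalProtocol n (Fin d) S Y (Fin d → ℝ)} (hQ : Q.IsLDP ε) (hε : 0 < ε) (hε' : ε ≤ ε₀)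
    (hδ : 0 < δ)
    (hloss : ∀ s, ∑ σ, loss hd ε Q σ δ s ≤ Fintype.card (Fin (d / 2) → Bool) * (1 / 20))
    {m : ℕ} (hm : m ≤ n) :
    Q.ManipulableOnData m (dataConst ε₀ * hiddenShift n m δ) ∧
      Q.ManipulableOnDistribution m (dataConst ε₀ * hiddenShift n m δ) := by
  let j₀ : Fin d := ⟨0, by omega⟩
  let j₁ : Fin d := ⟨1, by omega⟩
  have hj : j₀ ≠ j₁ := by simp [j₀, j₁]
  have hn0 : (0 : ℝ) < n := by exact_mod_cast hn
  set t := hiddenShift n m δ with ht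
  have ht0 : 0 ≤ t := hiddenShift_nonneg n m hδ
  have ht1 : t ≤ 1 := hiddenShift_le_one n m δ
  have hc1 : dataConst ε₀ ≤ 1 / 4 := min_le_left _ _
  have hc2 : dataConst ε₀ ≤ maskProb ε₀ / 32 := (min_le_right _ _).trans (min_le_left _ _)
  have hc3 : dataConst ε₀ ≤ 1 / (15 * √(8 / maskProb ε₀)) / 14 :=
    (min_le_right _ _).trans (min_le_right _ _)
  have hq := maskProb_pos ε₀
  obtain ⟨σ, M, hM⟩ := exists_simulation hQ hn hε hδ hloss hm j₀
  obtain ⟨D, M', hD⟩ := exists_contrast_error (contrast_pairUniform hd σ)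
    (contrast_tiltedPMF hd σ (hiddenShift_nonneg n m hδ) (hiddenShift_le_one n m δ)) hM
  constructor
  · rcases Nat.eq_zero_or_pos m with hm0 | hm0
    · have : t = 0 := by rw [ht, hiddenShift, hm0]; simp
      rw [this, mul_zero]
      exact manipulableOnData_zero Q j₀ m
    rcases lt_or_ge (n : ℝ) (32 / maskProb ε₀) with hsmall | hlarge
    · refine (manipulableOnData_of_one_user Q hn hj hm0).mono ?_
      rw [lt_div_iff₀ hq] at hsmall
      calc dataConst ε₀ * t ≤ maskProb ε₀ / 32 * 1 := by gcongr
        _ ≤ 1 / n := by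
          rw [mul_one, div_le_div_iff₀ (by norm_num) hn0]
          linarith
    -- Below `14 / √n` the hidden shift is within the error forced without corruption. Above it,
    -- Chebyshev applies with `u = t / 4`, since `n * u ^ 2 ≥ 196 / 16 = 49 / 4`.
    rcases lt_or_ge t (14 / √n) with htn | htn
    · refine (manipulableOnData_of_resampling hQ hε' (hε.le.trans hε') hj rfl rfl hlarge m).mono ?_
      calc dataConst ε₀ * t ≤ 1 / (15 * √(8 / maskProb ε₀)) / 14 * (14 / √n) := by gcongr
        _ = 1 / (15 * √(8 / maskProb ε₀)) / √n := by field_simp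
    · have htpos : 0 < t := lt_of_lt_of_le (by positivity) htn
      have hsq : 196 ≤ n * t ^ 2 := by
        have htn' := (div_le_iff₀ (by positivity)).1 htn
        calc (196 : ℝ) = 14 ^ 2 := by norm_num
          _ ≤ (t * √n) ^ 2 := by gcongr
          _ = n * t ^ 2 := by rw [mul_pow, Real.sq_sqrt hn0.le, mul_comm]
      refine (manipulableOnData_of_contrast (D := D) (M := M') (u := t / 4) hn (abs_pairSign_le σ)
        (by positivity) ?_ ?_).mono ?_
      · rw [div_le_div_iff₀ (by positivity) (by norm_num)]
        linarith
      · rw [show 2 * (t / 4) = t / 2 by ring]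
        exact hD
      · calc dataConst ε₀ * t ≤ 1 / 4 * t := by gcongr
          _ = t / 4 := by ring
  · refine (manipulableOnDistribution_of_contrast (abs_pairSign_le σ) hD).mono ?_
    calc dataConst ε₀ * t ≤ 1 / 4 * t := by gcongr
      _ ≤ t / 2 := by linarith

theorem rate_le_hiddenShift (hn : 1 ≤ n) (hd : 2 ≤ d) (hε : 0 < ε) (hε₀ : 0 ≤ ε₀) {N : ℕ}
    (hN : 1 ≤ N) {ℓ : ℝ} (hℓ : 0 < ℓ) (hNℓ : Real.log (20 * N) ≤ 6 * ℓ) (m : ℕ) :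
    1 / (60 * Real.exp ε₀) * min 1 ((m / n : ℝ) * (√d / (ε * √ℓ)))
      ≤ hiddenShift n m (threshold ε₀ ε d N) := by
  have hn0 : (0 : ℝ) < n := by exact_mod_cast hn
  have hd0 : (0 : ℝ) < d := by
    have : 0 < d := by omega
    exact_mod_cast this
  -- The worst case is `d = 3`. Then `2 * 6 / (1 / 3) = 6 ^ 2`, and `60` is this `6` times the `10`
  -- from Markov's inequality.
  have hK : (d : ℝ) / 3 ≤ (d / 2 : ℕ) := by
    rw [div_le_iff₀ (by norm_num)]
    have : d ≤ d / 2 * 3 := by omega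
    exact_mod_cast this
  have hδ0 := threshold_pos (ε₀ := ε₀) hε hd hN
  have hδ : threshold ε₀ ε d N ≤ 6 * Real.exp ε₀ * (ε * √ℓ) / √d := by
    have h1 : 2 * Real.log (20 * N) / (d / 2 : ℕ) ≤ 6 ^ 2 * ℓ / d := by
      calc 2 * Real.log (20 * N) / (d / 2 : ℕ) ≤ 2 * (6 * ℓ) / (d / 3) := by gcongr
        _ = 6 ^ 2 * ℓ / d := by field_simp; ring
    calc threshold ε₀ ε d N ≤ ε * Real.exp ε₀ * √(6 ^ 2 * ℓ / d) := by
          unfold threshold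
          gcongr
      _ = 6 * Real.exp ε₀ * (ε * √ℓ) / √d := by
          rw [Real.sqrt_div (by positivity), Real.sqrt_mul (by positivity),
            Real.sqrt_sq (by norm_num)]
          ring
  have hexp : 1 ≤ Real.exp ε₀ := Real.one_le_exp hε₀
  refine le_min ?_ ?_
  · calc 1 / (60 * Real.exp ε₀) * min 1 ((m / n : ℝ) * (√d / (ε * √ℓ)))
        ≤ 1 / (60 * Real.exp ε₀) * 1 := by gcongr; exact min_le_left _ _
      _ ≤ 1 := by
        rw [mul_one, div_le_one (by positivity)]
        linarith
  · calc 1 / (60 * Real.exp ε₀) * min 1 ((m / n : ℝ) * (√d / (ε * √ℓ)))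
        ≤ 1 / (60 * Real.exp ε₀) * ((m / n : ℝ) * (√d / (ε * √ℓ))) := by
          gcongr; exact min_le_right _ _
      _ = m / (10 * n * (6 * Real.exp ε₀ * (ε * √ℓ) / √d)) := by
          have : √(d : ℝ) ≠ 0 := by positivity
          field_simp
          ring
      _ ≤ m / (10 * n * threshold ε₀ ε d N) := by gcongr

theorem manipulable_and_breakdown_le (hd : 2 ≤ d) (hn : 1 ≤ n)
    {Q : LocalProtocol n (Fin d) S Y (Fin d → ℝ)} (hQ : Q.IsLDP ε) (hε : 0 < ε) (hε' : ε ≤ ε₀)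
    {N : ℕ} (hN : 1 ≤ N) {ℓ : ℝ} (hℓ : 0 < ℓ) (hNℓ : Real.log (20 * N) ≤ 6 * ℓ)
    (hloss : ∀ s, ∑ σ, loss hd ε Q σ (threshold ε₀ ε d N) s
      ≤ Fintype.card (Fin (d / 2) → Bool) * (1 / 20)) {c : ℝ}
    (hc : c = dataConst ε₀ * (1 / (60 * Real.exp ε₀))) :
    (∀ m : ℕ, m ≤ n →
      Q.ManipulableOnData m (c * min 1 ((m / n : ℝ) * (√d / (ε * √ℓ)))) ∧
      Q.ManipulableOnDistribution m (c * min 1 ((m / n : ℝ) * (√d / (ε * √ℓ))))) ∧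
    Q.breakdownOnData c ≤ 1 * (ε * √(ℓ / d)) ∧
    Q.breakdownOnDistribution c ≤ 1 * (ε * √(ℓ / d)) := by
  have hmain : ∀ m : ℕ, m ≤ n →
      Q.ManipulableOnData m (c * min 1 ((m / n : ℝ) * (√d / (ε * √ℓ)))) ∧
      Q.ManipulableOnDistribution m (c * min 1 ((m / n : ℝ) * (√d / (ε * √ℓ)))) := by
    intro m hm
    have h1 := manipulable_of_loss hd hn hQ hε hε' (threshold_pos hε hd hN) hloss hm
    have h2 : c * min 1 ((m / n : ℝ) * (√d / (ε * √ℓ)))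
        ≤ dataConst ε₀ * hiddenShift n m (threshold ε₀ ε d N) := by
      rw [hc, mul_assoc]
      exact mul_le_mul_of_nonneg_left
        (rate_le_hiddenShift hn hd hε (hε.le.trans hε') hN hℓ hNℓ m) (dataConst_pos ε₀).le
    exact ⟨h1.1.mono h2, h1.2.mono h2⟩
  exact ⟨hmain, breakdown_le_of_manipulable hd hε hℓ fun m hm => (hmain m hm).1,
    breakdown_le_of_manipulable hd hε hℓ fun m hm => (hmain m hm).2⟩

end Assembly

theorem mainTheorem3 (ε₀ : ℝ) (hε₀ : 0 < ε₀) :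
    ∃ c > (0 : ℝ), ∃ C > (0 : ℝ),
      ∀ (n d : ℕ) (_hn : 2 ≤ n) (_hd : 2 ≤ d) (ε : ℝ) (_hε : 0 < ε) (_hε' : ε ≤ ε₀)
        (S Y : Type*) [MeasurableSpace S] [MeasurableSpace Y]
        [MeasurableSpace.CountableOrCountablyGenerated S Y]
        (Q : LocalProtocol n (Fin d) S Y (Fin d → ℝ)) (_hQ : Q.IsLDP ε),
        ((∀ m : ℕ, m ≤ n →
            Q.ManipulableOnData m
              (c * min 1 ((m / n : ℝ) * (√d / (ε * √(Real.log n))))) ∧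
            Q.ManipulableOnDistribution m
              (c * min 1 ((m / n : ℝ) * (√d / (ε * √(Real.log n)))))) ∧
          Q.breakdownOnData c ≤ C * (ε * √(Real.log n / d)) ∧
          Q.breakdownOnDistribution c ≤ C * (ε * √(Real.log n / d))) ∧
        (Finite Y →
          (∀ m : ℕ, m ≤ n →
            Q.ManipulableOnData m
              (c * min 1 ((m / n : ℝ) * (√d / (ε * √(Real.log (12 * Q.complexity)))))) ∧
            Q.ManipulableOnDistribution m
              (c * min 1 ((m / n : ℝ) * (√d / (ε * √(Real.log (12 * Q.complexity))))))) ∧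
          Q.breakdownOnData c ≤ C * (ε * √(Real.log (12 * Q.complexity) / d)) ∧
          Q.breakdownOnDistribution c ≤ C * (ε * √(Real.log (12 * Q.complexity) / d))) := by
  refine ⟨dataConst ε₀ * (1 / (60 * Real.exp ε₀)),
    mul_pos (dataConst_pos ε₀) (by positivity), 1, one_pos, ?_⟩
  intro n d hn hd ε hε hε' S Y _ _ _ Q hQ
  have hn1 : 1 ≤ n := by omega
  refine ⟨?_, fun hY => ?_⟩
  · have hℓ : 0 < Real.log n := Real.log_pos (by exact_mod_cast hn)
    exact manipulable_and_breakdown_le hd hn1 hQ hε hε' hn1 hℓ (log_twenty_mul_le hn)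
      (sum_loss_le_of_users hQ hn1 hε hε') rfl
  · have hN := one_le_complexity hd hn1 Q
    have hN' : (1 : ℝ) ≤ Q.complexity := by exact_mod_cast hN
    exact manipulable_and_breakdown_le hd hn1 hQ hε hε' hN (Real.log_pos (by linarith))
      (log_twenty_mul_le' hN) (sum_loss_le_of_complexity hQ hN hε hε') rfl
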